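/- **Setting.** Let $n\ge 2$ and write $x=(x',x_n)\in\mathbb R^{n}$, $x'\in\mathbb R^{n-1}$. Consider the Stokes system in the half-space $$w_t-\Delta w+\nabla p=0,\quad \operatorname{div}w=0\ \text{ in }\mathbb R^n_+\times(0,2),\qquad w|_{t=0}=0,\quad w|_{x_n=0}=g,$$ with boundary data $g(y',s)=a\,\psi(|y'|)\,\phi(s)\,\mathbf e_n$, where $a>0$, the function $y'\mapsto\psi(|y'|)$ belongs to $C_c^\infty(B'_1)$, $\psi\ge 0$, and $\psi>1$ in $B'_{1/2}$ ($B'_r\subset\mathbb R^{n-1}$ is the open ball of radius $r$ about $0$). The solution meant is the one given by the Poisson kernel of the Stokes system in the half-space, whose pressure is, for $x_n>0$, $$\begin{aligned}p(x,t)=&-2\sum_{j=1}^n\int_{\mathbb R^{n-1}}D_{x_j}D_{x_n}N(x'-y',x_n)\,g_j(y',t)\,dy'-2D_t\int_{\mathbb R^{n-1}}N(x'-y',x_n)\,g_n(y',t)\,dy'\\&+4\sum_{j=1}^n(D_t-\Delta')\int_0^t\!\int_{\mathbb R^{n-1}}g_j(z',s)\int_{\mathbb R^{n-1}}D_{y_j}N(y',x_n)\,\Gamma(x'-y'-z',0,t-s)\,dy'\,dz'\,ds,\end{aligned}$$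 where $N$ is the Newtonian kernel of $\mathbb R^n$ (with $\Delta N=\delta$), $\Gamma$ the Gaussian heat kernel of $\mathbb R^n$, $\Delta'=\sum_{i<n}D_{x_i}^2$, and for $j=n$, $D_{y_j}N(y',x_n)$ means $(D_{x_n}N)(y',x_n)$. Put $p(x',0,t)=\lim_{x_n\to0+}p(x',x_n,t)$ and, for $1\le i\le n-1$, $$t^*_{p,i}(x')=\sup\{0<t<2:\ D_{x_i}p(x',0,s)<0\ \text{for all }s\in(0,t)\}\qquad(\sup\emptyset=0).$$ Assume $\phi\in C^{\frac12+\frac\alpha2}([0,2))$ for some $0<\alpha<1$, $\phi\in C^1(0,1)$, $\phi(0)=0$, $\phi$ is nondecreasing on $(0,1)$ and nonincreasing on $(1,2)$, $\phi>0$ on $(0,1)$ and $\phi\ge0$ on $(1,2)$. **Theorem.** Let $1\le i\le n-1$. For $|x'|>2$ and $0<t<1$ the limit $p(x',0,t)$ exists and is differentiable in $x'$, and the following hold. (i) For every $c>0$ there is a constant $c_*>2$, depending only on $n$ and $c$, such that: if $t_1\in(0,1)$ and $\phi(t)\le c\,t\,\phi'(t)$ for all $t\in(0,t_1)$, then $t_1<t^*_{p,i}(x')$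 for every $c_1>0$ and every $x'$ with $c_*<|x'|<c_1x_i$. (ii) If $\phi'(t_2)=0$ for some $0<t_2<1$, then $t^*_{p,i}(x')\le t_2$ for every $x'$ with $|x'|>2$ and $x_i>0$; in particular $t^*_{p,i}(x')\le1$. (iii) If moreover $\phi\in C^1(1,2)$, then for $|x'|>2$ and $1<t<2$ the limit $p(x',0,t)$ exists and is differentiable in $x'$; and for every $x'$ with $|x'|>2$ and $x_i>0$ one has $D_{x_i}p(x',0,t)>0$ for all $1<t<2$. Consequently $t^*_{p,i}(x')\le1$ for such $x'$, whether or not $\phi'$ vanishes in $(0,1)$. -/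

import Mathlib

open Set Filter Topology MeasureTheory
open scoped NNReal ContDiff

/-- Euclidean space `ℝᵏ`. -/
abbrev Eucl (k : ℕ) : Type := EuclideanSpace ℝ (Fin k)

noncomputable section

namespace HalfSpaceStokes

/-- The point `(x', xₙ)` of `ℝⁿ`, `n = d + 1`, with tangential part `x' ∈ ℝᵈ` and last (normal)
coordinate `xₙ`. -/
def bpt {d : ℕ} (x' : Eucl d) (xn : ℝ) : Eucl (d + 1) :=
  WithLp.toLp 2 (Fin.snoc (α := fun _ => ℝ) (fun i => x' i) xn)

/-- The tangential part `x'` of `x = (x', xₙ)`. -/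
def tang {d : ℕ} (x : Eucl (d + 1)) : Eucl d :=
  WithLp.toLp 2 (fun i => x i.castSucc)

/-- The normal coordinate `xₙ` of `x = (x', xₙ)`. -/
def normal {d : ℕ} (x : Eucl (d + 1)) : ℝ := x (Fin.last d)

/-- The classical partial derivative `D_{x_j} f (x)`. -/
def pderiv {k : ℕ} (j : Fin k) (f : Eucl k → ℝ) (x : Eucl k) : ℝ :=
  lineDeriv ℝ f x (EuclideanSpace.single j 1)

/-- The tangential Laplacian `Δ' = ∑_{i < n} D_{x_i}²` of a function of `x = (x', xₙ)`. -/
def tangLaplacian {d : ℕ} (f : Eucl (d + 1) → ℝ) (x : Eucl (d + 1)) : ℝ :=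
  ∑ i : Fin d, pderiv i.castSucc (pderiv i.castSucc f) x

/-- The Newtonian kernel `N` of `ℝᵏ`, `k ≥ 2`, normalised by `Δ N = δ`; the factor
`(volume (ball 0 1)).toReal` is the volume of the unit ball. -/
def newton {k : ℕ} (x : Eucl k) : ℝ :=
  if k = 2 then 1 / (2 * Real.pi) * Real.log ‖x‖
  else -(1 / ((k : ℝ) * ((k : ℝ) - 2) * (volume (Metric.ball (0 : Eucl k) 1)).toReal)) *
    ‖x‖ ^ (2 - (k : ℤ))

/-- The Gaussian kernel `Γ` of `ℝᵏ`, extended by `0` to `t ≤ 0`. -/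
def gauss {k : ℕ} (x : Eucl k) (t : ℝ) : ℝ :=
  if 0 < t then (4 * Real.pi * t) ^ (-(k : ℝ) / 2) * Real.exp (-‖x‖ ^ 2 / (4 * t)) else 0

/-- The potential
`∫₀ᵗ ∫ g_j(z', s) ∫ D_{y_j} N(y', xₙ) Γ(x' - y' - z', 0, t - s) dy' dz' ds`
(for `j = n`, `D_{y_j} N(y', xₙ)` is the normal derivative of `N` at `(y', xₙ)`). -/
def heatPotential {d : ℕ} (g : Eucl d → ℝ → Eucl (d + 1)) (j : Fin (d + 1))
    (x : Eucl (d + 1)) (t : ℝ) : ℝ :=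
  ∫ s in (0 : ℝ)..t, ∫ z : Eucl d, g z s j *
    ∫ y : Eucl d, pderiv j newton (bpt y (normal x)) * gauss (bpt (tang x - y - z) 0) (t - s)

/-- The pressure `p(x, t)`, `xₙ > 0`, of the solution `(w, p)` of the Stokes system
`w_t - Δw + ∇p = 0`, `div w = 0` in the half-space `ℝⁿ₊ × (0, T)`, `n = d + 1`, with `w = 0` at
`t = 0` and `w = g` on `xₙ = 0`, the solution being the one whose velocity is the Poisson integral
`w_i = ∑_j K_{ij} * g_j` of the boundary data (Solonnikov's kernel of the Stokes system; without
such a choice shear flows `(v(xₙ, t), 0)` with pressure `-f(t) x₁` could be added):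
`p = -2 ∑_j ∫ D_{x_j} D_{x_n} N(x' - y', xₙ) g_j(y', t) dy' - 2 D_t ∫ N(x' - y', xₙ) g_n(y', t) dy'
  + 4 ∑_j (D_t - Δ') ∫₀ᵗ ∫ g_j(z', s) ∫ D_{y_j} N(y', xₙ) Γ(x' - y' - z', 0, t - s) dy' dz' ds`. -/
def stokesPressure {d : ℕ} (g : Eucl d → ℝ → Eucl (d + 1)) (x : Eucl (d + 1)) (t : ℝ) : ℝ :=
  -2 * (∑ j : Fin (d + 1), ∫ y : Eucl d,
      pderiv j (pderiv (Fin.last d) newton) (bpt (tang x - y) (normal x)) * g y t j)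
  - 2 * (deriv (fun r => ∫ y : Eucl d,
      newton (bpt (tang x - y) (normal x)) * g y r (Fin.last d)) t)
  + 4 * (∑ j : Fin (d + 1),
      (deriv (fun r => heatPotential g j x r) t
        - tangLaplacian (fun ξ => heatPotential g j ξ t) x))

/-- The boundary value `p(x', 0, t) = lim_{xₙ → 0+} p(x', xₙ, t)`. -/
def boundaryPressure {d : ℕ} (g : Eucl d → ℝ → Eucl (d + 1)) (x' : Eucl d) (t : ℝ) : ℝ :=
  limUnder (𝓝[>] (0 : ℝ)) (fun xn => stokesPressure g (bpt x' xn) t)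

/-- The boundary pressure is meaningful near `(x', t)`: for all `y'` near `x'` the pressure has a
limit as `xₙ → 0+`, and the limit is differentiable at `x'`. -/
def HasBoundaryPressure {d : ℕ} (g : Eucl d → ℝ → Eucl (d + 1)) (x' : Eucl d) (t : ℝ) : Prop :=
  (∀ᶠ y' in 𝓝 x', Tendsto (fun xn => stokesPressure g (bpt y' xn) t) (𝓝[>] (0 : ℝ))
    (𝓝 (boundaryPressure g y' t))) ∧
  DifferentiableAt ℝ (fun y' => boundaryPressure g y' t) x'

/-- The tangential derivative `D_{x_i} p(x', 0, t)`. -/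
def tangPressureDeriv {d : ℕ} (g : Eucl d → ℝ → Eucl (d + 1)) (i : Fin d) (x' : Eucl d)
    (t : ℝ) : ℝ :=
  pderiv i (fun y' => boundaryPressure g y' t) x'

/-- `t*_{p,i}(x') = sup {0 < t < 2 | D_{x_i} p(x', 0, s) < 0 for all s ∈ (0, t)}`
(`0` if there is no such `t`). -/
def pressureTime {d : ℕ} (g : Eucl d → ℝ → Eucl (d + 1)) (i : Fin d) (x' : Eucl d) : ℝ :=
  sSup {t : ℝ | 0 < t ∧ t < 2 ∧ ∀ s ∈ Ioo 0 t, tangPressureDeriv g i x' s < 0}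

/-- The boundary data `g(y', s) = a ψ(|y'|) φ(s) eₙ`. -/
def bdryData (d : ℕ) (a : ℝ) (ψ φ : ℝ → ℝ) (y : Eucl d) (s : ℝ) : Eucl (d + 1) :=
  EuclideanSpace.single (Fin.last d) (a * ψ ‖y‖ * φ s)

/-- The spatial profile: `y' ↦ ψ(|y'|)` is in `C_c^∞(B'_1)`, nonnegative, and `> 1` in `B'_{1/2}`. -/
structure IsSpatialProfile (d : ℕ) (ψ : ℝ → ℝ) : Prop where
  smooth : ContDiff ℝ ∞ (fun y : Eucl d => ψ ‖y‖)
  supp : tsupport (fun y : Eucl d => ψ ‖y‖) ⊆ Metric.ball 0 1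
  nonneg : ∀ y : Eucl d, 0 ≤ ψ ‖y‖
  one_lt : ∀ y ∈ Metric.ball (0 : Eucl d) (1 / 2), 1 < ψ ‖y‖

/-- The temporal profile: `φ ∈ C^{1/2 + α/2}([0, 2))` for some `0 < α < 1`, `φ ∈ C¹(0, 1)`,
`φ(0) = 0`, `φ` is increasing on `(0, 1)` and decreasing on `(1, 2)`, and it describes an inflow:
`φ > 0` on `(0, 1)` (automatic if `φ` increases strictly there) and `φ ≥ 0` on `(1, 2)`. -/
structure IsTemporalProfile (φ : ℝ → ℝ) : Prop where
  holder : ∃ α C : ℝ≥0, 0 < α ∧ α < 1 ∧ HolderOnWith C (1 / 2 + α / 2) φ (Ico 0 2)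
  contDiff : ContDiffOn ℝ 1 φ (Ioo 0 1)
  zero : φ 0 = 0
  mono : MonotoneOn φ (Ioo 0 1)
  anti : AntitoneOn φ (Ioo 1 2)
  pos : ∀ t ∈ Ioo (0 : ℝ) 1, 0 < φ t
  nonneg : ∀ t ∈ Ioo (1 : ℝ) 2, 0 ≤ φ t

end HalfSpaceStokes

end

/-! Away from the support of the data the boundary pressure is an explicit radial potential, the
integral of `a * ψ ‖z‖` against `pressureProfile` at the squared distance from x' to z. The
Newtonian terms pass to the limit xₙ → 0 directly. In the heat term, up to constants, the normal
derivative of N is a Poisson kernel of scale xₙ, and the Gaussian of ℝⁿ on the boundary is τ^(-1/2)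
times the heat kernel of ℝⁿ⁻¹. So the potential is a time convolution of φ with τ^(-1/2) times a
Poisson-Gauss average of ψ (`heatPotential_last`).

The average solves the heat equation (`hasDerivAt_smear_time`), so in the limit the operator D_t -
Δ' only differentiates the factor τ^(-1/2). For xₙ > 0 the kernel may really be singular at τ = 0,
because the Poisson tail reaches x'. Therefore `hasDerivAt_conv` moves the time derivative onto φ
for small τ and onto the kernel for the other τ. At xₙ = 0 the kernel is flat at τ = 0
(`abs_smear_zero_le`), and what remains is -1/2 times the convolution with τ^(-3/2) times the
average (`tendsto_deriv_convPot_sub_laplacian`).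

The potential is rotation invariant, so D_{x_i} is x_i / ‖x'‖² times the derivative along x'
(`fderiv_radial_apply`). Since (x' - z) · x' > 0 for ‖z‖ ≤ 1, a fixed sign of `pressureProfileDeriv`
at all relevant distances is inherited by D_{x_i} p. Up to positive constants this function of ρ is
φ ρ^(-(n+2)/2) - φ' ρ^(-n/2) plus a weighted integral of the past values of φ. If φ' = 0 at a time
before 1, the first term makes it positive. After time 1, φ' ≤ 0 and the past inflow makes it
positive. If φ ≤ c t φ', the φ' term decays slowest in ρ and wins at large distance
(`pressureProfileDeriv_neg`). -/

noncomputable section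

namespace HalfSpaceStokes

/-! ### Coordinates of the half-space -/

@[simp] lemma tang_bpt {d : ℕ} (y : Eucl d) (r : ℝ) : tang (bpt y r) = y := by
  ext i; simp [tang, bpt]

@[simp] lemma normal_bpt {d : ℕ} (y : Eucl d) (r : ℝ) : normal (bpt y r) = r := by
  simp [normal, bpt]

lemma norm_sq_bpt {d : ℕ} (y : Eucl d) (r : ℝ) : ‖bpt y r‖ ^ 2 = ‖y‖ ^ 2 + r ^ 2 := by
  rw [EuclideanSpace.real_norm_sq_eq, EuclideanSpace.real_norm_sq_eq, Fin.sum_univ_castSucc]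
  simp [bpt]

lemma bpt_add_smul_last {d : ℕ} (y : Eucl d) (r h : ℝ) :
    bpt y r + h • EuclideanSpace.single (Fin.last d) (1 : ℝ) = bpt y (r + h) := by
  ext i
  refine Fin.lastCases ?_ (fun j => ?_) i <;> simp [bpt, (Fin.castSucc_lt_last _).ne]

lemma bpt_add_smul_castSucc {d : ℕ} (y : Eucl d) (r h : ℝ) (i : Fin d) :
    bpt y r + h • EuclideanSpace.single i.castSucc (1 : ℝ)
      = bpt (y + h • EuclideanSpace.single i (1 : ℝ)) r := by
  ext j
  refine Fin.lastCases ?_ (fun j => ?_) j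
  · simp [bpt, (Fin.castSucc_lt_last _).ne']
  · by_cases h : j = i <;> simp [bpt, h]

/-! ### The Newtonian kernel and its normal derivatives -/

/-- The constant `1 / (n ωₙ)`, `n = d + 1`, in `∇N(x) = x / (n ωₙ |x|ⁿ)`. -/
def newtonConst (d : ℕ) : ℝ :=
  if d + 1 = 2 then 1 / (2 * Real.pi)
  else 1 / (((d + 1 : ℕ) : ℝ) * (volume (Metric.ball (0 : Eucl (d + 1)) 1)).toReal)

/-- The Newtonian kernel of `ℝᵈ⁺¹` as a function of `|x|²`. -/
def newtonRadial (d : ℕ) (ρ : ℝ) : ℝ :=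
  if d + 1 = 2 then 1 / (4 * Real.pi) * Real.log ρ
  else -(1 / (((d + 1 : ℕ) : ℝ) * (((d + 1 : ℕ) : ℝ) - 2)
    * (volume (Metric.ball (0 : Eucl (d + 1)) 1)).toReal)) * ρ ^ ((1 - (d : ℝ)) / 2)

lemma volume_unitBall_pos (k : ℕ) : 0 < (volume (Metric.ball (0 : Eucl k) 1)).toReal :=
  ENNReal.toReal_pos (Metric.measure_ball_pos _ _ one_pos).ne' measure_ball_lt_top.ne

lemma newtonConst_pos (d : ℕ) : 0 < newtonConst d := by
  unfold newtonConst
  have := volume_unitBall_pos (d + 1)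
  split_ifs <;> positivity

lemma newton_eq_newtonRadial {d : ℕ} (x : Eucl (d + 1)) :
    newton x = newtonRadial d (‖x‖ ^ 2) := by
  unfold newton newtonRadial
  split_ifs with h
  · rw [Real.log_pow]; push_cast; ring
  · congr 1
    rw [← Real.rpow_intCast, ← Real.rpow_natCast ‖x‖ 2, ← Real.rpow_mul (norm_nonneg _)]
    congr 1
    push_cast; ring

/-- The logarithm and the power have the same form of derivative in |x|². Later arguments use only
this derivative and continuity, so the distinction n = 2 ends here. -/
lemma hasDerivAt_newtonRadial (d : ℕ) {ρ : ℝ} (hρ : 0 < ρ) :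
    HasDerivAt (newtonRadial d) (newtonConst d / 2 * ρ ^ (-((d : ℝ) + 1) / 2)) ρ := by
  unfold newtonRadial newtonConst
  split_ifs with h
  · have hd : d = 1 := by omega
    subst hd
    have := (Real.hasDerivAt_log hρ.ne').const_mul (1 / (4 * Real.pi))
    refine this.congr_deriv ?_
    rw [show (-(((1 : ℕ) : ℝ) + 1) / 2) = ((-1 : ℤ) : ℝ) by norm_num, Real.rpow_intCast, zpow_neg_one]
    field_simp; norm_num
  · have h1 : (d : ℝ) - 1 ≠ 0 := by
      intro h'
      apply h
      have : (d : ℝ) = 1 := by linarith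
      have : d = 1 := by exact_mod_cast this
      omega
    have hv := volume_unitBall_pos (d + 1)
    have := ((hasDerivAt_id ρ).rpow_const (p := (1 - (d : ℝ)) / 2) (Or.inl hρ.ne')).const_mul
      (-(1 / (((d + 1 : ℕ) : ℝ) * (((d + 1 : ℕ) : ℝ) - 2)
    * (volume (Metric.ball (0 : Eucl (d + 1)) 1)).toReal)))
    refine this.congr_deriv ?_
    rw [show (1 - (d : ℝ)) / 2 - 1 = -((d : ℝ) + 1) / 2 by ring]
    simp only [id]
    generalize ρ ^ (-((d : ℝ) + 1) / 2) = A
    have h2 : ((d + 1 : ℕ) : ℝ) - 2 ≠ 0 := by push_cast; intro h'; apply h1; linarith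
    have h3 : ((d + 1 : ℕ) : ℝ) ≠ 0 := by positivity
    field_simp
    push_cast; ring

lemma continuousOn_newtonRadial (d : ℕ) : ContinuousOn (newtonRadial d) (Ioi 0) :=
  fun _ h => (hasDerivAt_newtonRadial d h).continuousAt.continuousWithinAt

lemma pderiv_last_newton {d : ℕ} (y : Eucl d) (r : ℝ) (h : 0 < ‖y‖ ^ 2 + r ^ 2) :
    pderiv (Fin.last d) newton (bpt y r)
      = newtonConst d * (r * (‖y‖ ^ 2 + r ^ 2) ^ (-((d : ℝ) + 1) / 2)) := by
  unfold pderiv lineDeriv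
  simp only [bpt_add_smul_last, newton_eq_newtonRadial, norm_sq_bpt]
  have h1 : HasDerivAt (fun s : ℝ => ‖y‖ ^ 2 + (r + s) ^ 2) (2 * r) 0 := by
    have := (((hasDerivAt_id (0 : ℝ)).const_add r).pow 2).const_add (‖y‖ ^ 2)
    simpa using this
  have h0 : HasDerivAt (newtonRadial d)
      (newtonConst d / 2 * (‖y‖ ^ 2 + r ^ 2) ^ (-((d : ℝ) + 1) / 2)) (‖y‖ ^ 2 + (r + 0) ^ 2) := by
    rw [add_zero]
    exact hasDerivAt_newtonRadial d h
  have h2 := HasDerivAt.comp (0 : ℝ) h0 h1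
  rw [show (fun s => newtonRadial d (‖y‖ ^ 2 + (r + s) ^ 2))
    = newtonRadial d ∘ (fun s : ℝ => ‖y‖ ^ 2 + (r + s) ^ 2) from rfl, h2.deriv]
  ring

lemma pderiv_last_pderiv_last_newton {d : ℕ} (y : Eucl d) (r : ℝ) (h : 0 < r) :
    pderiv (Fin.last d) (pderiv (Fin.last d) newton) (bpt y r)
      = newtonConst d * ((‖y‖ ^ 2 + r ^ 2) ^ (-((d : ℝ) + 1) / 2)
        - ((d : ℝ) + 1) * r ^ 2 * (‖y‖ ^ 2 + r ^ 2) ^ (-((d : ℝ) + 3) / 2)) := by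
  have hpos : 0 < ‖y‖ ^ 2 + r ^ 2 := by positivity
  rw [pderiv, lineDeriv]
  simp only [bpt_add_smul_last]
  -- The formula for the first derivative needs a point off the origin; r + s > 0 ensures this for s
  -- near 0.
  have hev : (fun s : ℝ => pderiv (Fin.last d) newton (bpt y (r + s))) =ᶠ[𝓝 0] fun s : ℝ =>
      newtonConst d * ((r + s) * (‖y‖ ^ 2 + (r + s) ^ 2) ^ (-((d : ℝ) + 1) / 2)) := by
    filter_upwards [lt_mem_nhds (neg_lt_zero.mpr h)] with s hs
    have : 0 < r + s := by linarith
    exact pderiv_last_newton _ _ (by positivity)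
  rw [hev.deriv_eq]
  have h0 : HasDerivAt (fun s : ℝ => r + s) 1 0 := (hasDerivAt_id (0 : ℝ)).const_add r
  have h1 : HasDerivAt (fun s : ℝ => ‖y‖ ^ 2 + (r + s) ^ 2) (2 * r) 0 := by
    have := (h0.pow 2).const_add (‖y‖ ^ 2)
    simpa using this
  have h2 := h1.rpow_const (p := -((d : ℝ) + 1) / 2) (Or.inl (by simpa using hpos.ne'))
  have h3 := (h0.mul h2).const_mul (newtonConst d)
  refine h3.deriv.trans ?_
  simp only [add_zero]
  rw [show -((d : ℝ) + 1) / 2 - 1 = -((d : ℝ) + 3) / 2 by ring]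
  ring

/-! ### Test functions -/

/-- Smooth functions supported in the open unit ball. -/
structure IsTest {d : ℕ} (f : Eucl d → ℝ) : Prop where
  smooth : ContDiff ℝ ∞ f
  supp : tsupport f ⊆ Metric.ball 0 1

/-- The Laplacian of a function on `ℝᵈ`. -/
def laplacian {d : ℕ} (f : Eucl d → ℝ) (x : Eucl d) : ℝ := ∑ i, pderiv i (pderiv i f) x

namespace IsTest

variable {d : ℕ} {f : Eucl d → ℝ}

lemma continuous (hf : IsTest f) : Continuous f := hf.smooth.continuous

lemma differentiable (hf : IsTest f) : Differentiable ℝ f := hf.smooth.differentiable (by simp)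

lemma hasCompactSupport (hf : IsTest f) : HasCompactSupport f :=
  HasCompactSupport.intro (isCompact_closedBall (0 : Eucl d) 1) fun x hx => by
    by_contra h
    exact hx (Metric.ball_subset_closedBall (hf.supp (subset_tsupport _ h)))

lemma bounded (hf : IsTest f) : ∃ C, 0 ≤ C ∧ ∀ x, |f x| ≤ C := by
  obtain ⟨C, hC⟩ := hf.hasCompactSupport.exists_bound_of_continuous hf.continuous
  exact ⟨C, (norm_nonneg _).trans (hC 0), hC⟩

lemma eq_zero (hf : IsTest f) {x : Eucl d} (hx : 1 ≤ ‖x‖) : f x = 0 := by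
  by_contra h
  have := hf.supp (subset_tsupport _ h)
  rw [mem_ball_zero_iff] at this
  linarith

lemma pderiv_eq (hf : IsTest f) (i : Fin d) (x : Eucl d) :
    pderiv i f x = fderiv ℝ f x (EuclideanSpace.single i 1) :=
  (hf.differentiable x).lineDeriv_eq_fderiv

lemma pderiv (hf : IsTest f) (i : Fin d) : IsTest (pderiv i f) := by
  have he : HalfSpaceStokes.pderiv i f = fun x => fderiv ℝ f x (EuclideanSpace.single i 1) :=
    funext (hf.pderiv_eq i)
  refine ⟨?_, ?_⟩
  · rw [he]
    exact (hf.smooth.fderiv_right (m := ∞) (by simp)).clm_apply contDiff_const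
  · refine Subset.trans ?_ hf.supp
    rw [he]
    exact (tsupport_comp_subset (g := fun L : Eucl d →L[ℝ] ℝ => L (EuclideanSpace.single i 1))
      (by simp) _).trans (tsupport_fderiv_subset ℝ)

lemma laplacian (hf : IsTest f) : IsTest (laplacian f) := by
  refine ⟨?_, ?_⟩
  · exact ContDiff.sum fun i _ => ((hf.pderiv i).pderiv i).smooth
  · have hsub : Function.support (HalfSpaceStokes.laplacian f) ⊆ tsupport f := by
      intro x hx
      by_contra hxf
      apply hx
      refine Finset.sum_eq_zero fun i _ => ?_
      have h1 : f =ᶠ[𝓝 x] 0 := notMem_tsupport_iff_eventuallyEq.1 hxf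
      have h2 : HalfSpaceStokes.pderiv i f =ᶠ[𝓝 x] 0 := by
        filter_upwards [eventually_eventually_nhds.2 h1] with y hy
        rw [hf.pderiv_eq, (show f =ᶠ[𝓝 y] 0 from hy).fderiv_eq]
        simp
      rw [(hf.pderiv i).pderiv_eq, h2.fderiv_eq]
      simp
    exact (closure_minimal hsub (isClosed_tsupport f)).trans hf.supp

lemma hasDerivAt_line (hf : IsTest f) (i : Fin d) (x : Eucl d) (h : ℝ) :
    HasDerivAt (fun h : ℝ => f (x + h • EuclideanSpace.single i (1 : ℝ)))
      (HalfSpaceStokes.pderiv i f (x + h • EuclideanSpace.single i (1 : ℝ))) h := by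
  have h1 : HasDerivAt (fun h : ℝ => x + h • EuclideanSpace.single i (1 : ℝ))
      (EuclideanSpace.single i (1 : ℝ)) h := by
    simpa using ((hasDerivAt_id h).smul_const (EuclideanSpace.single i (1 : ℝ))).const_add x
  rw [hf.pderiv_eq]
  exact (hf.differentiable _).hasFDerivAt.comp_hasDerivAt h h1

end IsTest

/-! ### The Poisson and Gauss weights -/

/-- The Poisson kernel of the half-space at height `1`, up to a constant. -/
def poissonWeight {d : ℕ} (y : Eucl d) : ℝ := (1 + ‖y‖ ^ 2) ^ (-((d : ℝ) + 1) / 2)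

/-- The Gaussian kernel of `ℝᵈ` at time `1`, up to a constant. -/
def gaussWeight {d : ℕ} (v : Eucl d) : ℝ := Real.exp (-‖v‖ ^ 2 / 4)

/-- The product of the Poisson and the Gauss weight. -/
def weight {d : ℕ} (p : Eucl d × Eucl d) : ℝ := poissonWeight p.1 * gaussWeight p.2

section Weights

variable {d : ℕ}

lemma poissonWeight_pos (y : Eucl d) : 0 < poissonWeight y := by
  unfold poissonWeight; positivity

lemma gaussWeight_pos (v : Eucl d) : 0 < gaussWeight v := Real.exp_pos _

lemma weight_pos (p : Eucl d × Eucl d) : 0 < weight p :=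
  mul_pos (poissonWeight_pos _) (gaussWeight_pos _)

@[fun_prop]
lemma continuous_poissonWeight : Continuous (poissonWeight (d := d)) := by
  unfold poissonWeight
  exact Continuous.rpow_const (by fun_prop) fun y => Or.inl (by positivity)

@[fun_prop]
lemma continuous_gaussWeight : Continuous (gaussWeight (d := d)) := by
  unfold gaussWeight; fun_prop

@[fun_prop]
lemma continuous_weight : Continuous (weight (d := d)) := by
  unfold weight; fun_prop

lemma integrable_poissonWeight : Integrable (poissonWeight (d := d)) := by
  have := integrable_rpow_neg_one_add_norm_sq (E := Eucl d) (μ := volume) (r := (d : ℝ) + 1)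
    (by simp)
  exact this

lemma integrable_exp_neg_mul_norm_sq {b : ℝ} (hb : 0 < b) :
    Integrable (fun v : Eucl d => Real.exp (-b * ‖v‖ ^ 2)) := by
  have := (GaussianFourier.integrable_cexp_neg_mul_sq_norm_add (V := Eucl d) (b := (b : ℂ))
    (by simpa using hb) 0 0).norm
  refine this.congr (Eventually.of_forall fun v => ?_)
  simp only [Complex.norm_exp]
  congr 1
  simp [← Complex.ofReal_pow]

/-- Half of the Gaussian absorbs ‖v‖⁴ through u²/2 ≤ exp u at u = ‖v‖²/8, whence the factor 128. The
fourth moment is what produces τ² in `abs_smear_zero_le`. -/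
lemma integrable_gaussWeight_mul_norm_pow_four :
    Integrable (fun v : Eucl d => gaussWeight v * ‖v‖ ^ 4) := by
  refine ((integrable_exp_neg_mul_norm_sq (d := d) (b := 1 / 8) (by norm_num)).const_mul 128).mono'
    (by fun_prop) (Eventually.of_forall fun v => ?_)
  have h1 : (‖v‖ ^ 2 / 8) ^ 2 / 2 ≤ Real.exp (‖v‖ ^ 2 / 8) := by
    have := Real.quadratic_le_exp_of_nonneg (x := ‖v‖ ^ 2 / 8) (by positivity)
    nlinarith [sq_nonneg ‖v‖]
  have h2 : gaussWeight v = Real.exp (-(1 / 8) * ‖v‖ ^ 2) * Real.exp (-(‖v‖ ^ 2 / 8)) := by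
    rw [← Real.exp_add, gaussWeight]; congr 1; ring
  have h3 : Real.exp (-(‖v‖ ^ 2 / 8)) * Real.exp (‖v‖ ^ 2 / 8) = 1 := by
    rw [← Real.exp_add]; simp
  rw [Real.norm_of_nonneg (mul_nonneg (gaussWeight_pos v).le (by positivity)), h2, mul_assoc,
    mul_comm 128]
  refine mul_le_mul_of_nonneg_left ?_ (Real.exp_pos _).le
  have h4 := mul_le_mul_of_nonneg_left h1 (Real.exp_pos (-(‖v‖ ^ 2 / 8))).le
  rw [h3] at h4
  nlinarith

lemma integrable_gaussWeight : Integrable (gaussWeight (d := d)) := by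
  refine (integrable_exp_neg_mul_norm_sq (d := d) (b := 1 / 4) (by norm_num)).congr
    (Eventually.of_forall fun v => ?_)
  simp only [gaussWeight]; congr 1; ring

lemma integrable_gaussWeight_mul_norm :
    Integrable (fun v : Eucl d => gaussWeight v * ‖v‖) := by
  refine (integrable_gaussWeight.add integrable_gaussWeight_mul_norm_pow_four).mono'
    (by fun_prop) (Eventually.of_forall fun v => ?_)
  rw [Real.norm_of_nonneg (mul_nonneg (gaussWeight_pos v).le (by positivity))]
  have : ‖v‖ ≤ 1 + ‖v‖ ^ 4 := by nlinarith [sq_nonneg (‖v‖ - 1), sq_nonneg (‖v‖ ^ 2 - 1)]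
  have := mul_le_mul_of_nonneg_left this (gaussWeight_pos v).le
  simp only [Pi.add_apply]; linarith

lemma integrable_weight : Integrable (weight (d := d)) :=
  integrable_poissonWeight.mul_prod integrable_gaussWeight

lemma integrable_weight_mul_norm : Integrable (fun p : Eucl d × Eucl d => weight p * ‖p.2‖) := by
  simp only [weight, mul_assoc]
  exact integrable_poissonWeight.mul_prod (integrable_gaussWeight_mul_norm (d := d))

lemma integrable_weight_mul_norm_pow_four :
    Integrable (fun p : Eucl d × Eucl d => weight p * ‖p.2‖ ^ 4) := by
  simp only [weight, mul_assoc]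
  exact integrable_poissonWeight.mul_prod (integrable_gaussWeight_mul_norm_pow_four (d := d))

lemma integral_poissonWeight_pos : 0 < ∫ y : Eucl d, poissonWeight y :=
  integral_pos_of_integrable_nonneg_nonzero (x := 0) continuous_poissonWeight
    integrable_poissonWeight (fun y => (poissonWeight_pos y).le) (poissonWeight_pos _).ne'

lemma hasLineDerivAt_weight (p : Eucl d × Eucl d) (i : Fin d) :
    HasLineDerivAt ℝ weight (-(p.2 i / 2) * weight p) p (0, EuclideanSpace.single i (1 : ℝ)) := by
  unfold HasLineDerivAt
  have h0 : (fun h : ℝ => weight (p + h • ((0 : Eucl d), EuclideanSpace.single i (1 : ℝ))))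
      = fun h : ℝ => poissonWeight p.1 * Real.exp (-(‖p.2‖ ^ 2 + 2 * h * p.2 i + h ^ 2) / 4) := by
    funext h
    simp only [weight, gaussWeight, Prod.fst_add, Prod.snd_add, Prod.smul_fst, Prod.smul_snd,
      smul_zero, add_zero]
    rw [norm_add_sq_real, inner_smul_right, norm_smul, EuclideanSpace.inner_single_right]
    simp [mul_assoc]
  rw [h0]
  have h1 : HasDerivAt (fun h : ℝ => -(‖p.2‖ ^ 2 + 2 * h * p.2 i + h ^ 2) / 4) (-(p.2 i / 2)) 0 := by
    have h2 := (((hasDerivAt_id (0 : ℝ)).const_mul 2).mul_const (p.2 i)).const_add (‖p.2‖ ^ 2)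
    have h3 := ((h2.add ((hasDerivAt_id (0 : ℝ)).pow 2)).neg).div_const 4
    refine h3.congr_deriv ?_
    simp; ring
  refine ((h1.exp).const_mul (poissonWeight p.1)).congr_deriv ?_
  simp [weight, gaussWeight]; ring

end Weights

/-! ### The Poisson-Gauss average -/

/-- The average of `f` at `x` against the Poisson kernel of scale `ε` and the Gaussian kernel at
time `τ` (up to a constant). -/
def smear {d : ℕ} (f : Eucl d → ℝ) (x : Eucl d) (ε τ : ℝ) : ℝ :=
  ∫ p : Eucl d × Eucl d, weight p * f (x - ε • p.1 - √τ • p.2)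

section Smear

variable {d : ℕ} {f : Eucl d → ℝ}

lemma integrable_smear (hf : IsTest f) (x : Eucl d) (ε τ : ℝ) :
    Integrable (fun p : Eucl d × Eucl d => weight p * f (x - ε • p.1 - √τ • p.2)) := by
  obtain ⟨C, -, hC⟩ := hf.bounded
  have := hf.continuous
  exact integrable_weight.mul_bdd (c := C) (by fun_prop)
    (Eventually.of_forall fun p => hC _)

/-- The weights are fixed and the scales sit inside the argument of `f`, so ε = 0 and τ = 0 are
ordinary parameter values and dominated convergence covers them. -/
lemma continuous_smear (hf : IsTest f) :
    Continuous (fun u : Eucl d × ℝ × ℝ => smear f u.1 u.2.1 u.2.2) := by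
  obtain ⟨C, -, hC⟩ := hf.bounded
  have := hf.continuous
  refine continuous_of_dominated (bound := fun p => weight p * C) (fun u => by fun_prop)
    (fun u => Eventually.of_forall fun p => ?_) (integrable_weight.mul_const C)
    (Eventually.of_forall fun p => by fun_prop)
  rw [norm_mul, Real.norm_of_nonneg (weight_pos p).le]
  exact mul_le_mul_of_nonneg_left (hC _) (weight_pos p).le

lemma abs_smear_le {C : ℝ} (hC : ∀ x, |f x| ≤ C) (x : Eucl d) (ε τ : ℝ) :
    |smear f x ε τ| ≤ (∫ p : Eucl d × Eucl d, weight p) * C := by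
  rw [← integral_mul_const, ← Real.norm_eq_abs, smear]
  refine norm_integral_le_of_norm_le (integrable_weight.mul_const C)
    (Eventually.of_forall fun p => ?_)
  rw [norm_mul, Real.norm_of_nonneg (weight_pos p).le]
  exact mul_le_mul_of_nonneg_left (hC _) (weight_pos p).le

lemma smear_bounded (hf : IsTest f) : ∃ C, 0 ≤ C ∧ ∀ x ε τ, |smear f x ε τ| ≤ C := by
  obtain ⟨C, -, hC⟩ := hf.bounded
  exact ⟨_, (abs_nonneg _).trans (abs_smear_le hC 0 0 0), abs_smear_le hC⟩

lemma hasDerivAt_smear_line (hf : IsTest f) (i : Fin d) (x : Eucl d) (ε τ h : ℝ) :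
    HasDerivAt (fun h : ℝ => smear f (x + h • EuclideanSpace.single i (1 : ℝ)) ε τ)
      (smear (pderiv i f) (x + h • EuclideanSpace.single i (1 : ℝ)) ε τ) h := by
  obtain ⟨C, -, hC⟩ := (hf.pderiv i).bounded
  have h1 := hf.continuous
  have h2 := (hf.pderiv i).continuous
  refine (hasDerivAt_integral_of_dominated_loc_of_deriv_le (s := univ) (μ := volume)
    (F := fun h (p : Eucl d × Eucl d) =>
      weight p * f (x + h • EuclideanSpace.single i (1 : ℝ) - ε • p.1 - √τ • p.2))
    (F' := fun h (p : Eucl d × Eucl d) =>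
      weight p * pderiv i f (x + h • EuclideanSpace.single i (1 : ℝ) - ε • p.1 - √τ • p.2))
    (bound := fun p => weight p * C) univ_mem
    (Eventually.of_forall fun h => by fun_prop) (integrable_smear hf _ _ _)
    (by fun_prop) (Eventually.of_forall fun p h _ => ?_) (integrable_weight.mul_const C)
    (Eventually.of_forall fun p h _ => ?_)).2
  · rw [norm_mul, Real.norm_of_nonneg (weight_pos p).le]
    exact mul_le_mul_of_nonneg_left (hC _) (weight_pos p).le
  · have h3 := (hf.hasDerivAt_line i (x - ε • p.1 - √τ • p.2) h).const_mul (weight p)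
    have h4 : ∀ h : ℝ, x - ε • p.1 - √τ • p.2 + h • EuclideanSpace.single i (1 : ℝ)
        = x + h • EuclideanSpace.single i (1 : ℝ) - ε • p.1 - √τ • p.2 := fun h => by abel
    simpa only [h4] using h3

/-- Gaussian integration by parts: v_i exp(-|v|²/4) is -2 times the i-th derivative of the Gaussian,
and differentiating `f` along v_i costs the inner factor -√τ. -/
lemma integral_weight_mul_coord (hf : IsTest f) (i : Fin d) (x : Eucl d) (ε τ : ℝ) :
    ∫ p : Eucl d × Eucl d, weight p * (p.2 i * f (x - ε • p.1 - √τ • p.2))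
      = -2 * √τ * smear (pderiv i f) x ε τ := by
  obtain ⟨C, -, hC⟩ := hf.bounded
  have hc := hf.continuous
  have hint : Integrable
      (fun p : Eucl d × Eucl d => -(p.2 i / 2) * weight p * f (x - ε • p.1 - √τ • p.2)) := by
    have h1 : Integrable (fun p : Eucl d × Eucl d => -(p.2 i / 2) * weight p) := by
      refine (integrable_weight_mul_norm (d := d)).mono' (by fun_prop)
        (Eventually.of_forall fun p => ?_)
      rw [norm_mul, Real.norm_of_nonneg (weight_pos p).le, mul_comm]
      refine mul_le_mul_of_nonneg_left ?_ (weight_pos p).le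
      have := PiLp.norm_apply_le p.2 i
      rw [norm_neg, norm_div]
      have h2 := norm_nonneg (p.2 i)
      simp only [Real.norm_ofNat]; linarith
    exact h1.mul_bdd (c := C) (by fun_prop) (Eventually.of_forall fun p => hC _)
  have key := integral_bilinear_hasLineDerivAt_right_eq_neg_left_of_integrable
    (μ := (volume : Measure (Eucl d)).prod (volume : Measure (Eucl d))) (B := ContinuousLinearMap.mul ℝ ℝ)
    (f := weight) (f' := fun p => -(p.2 i / 2) * weight p)
    (g := fun p => f (x - ε • p.1 - √τ • p.2))
    (g' := fun p => -√τ * pderiv i f (x - ε • p.1 - √τ • p.2))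
    (v := ((0 : Eucl d), EuclideanSpace.single i (1 : ℝ)))
    hint (by
      have := (integrable_smear (hf.pderiv i) x ε τ).const_mul (-√τ)
      refine this.congr (Eventually.of_forall fun p => ?_)
      simp only [ContinuousLinearMap.mul_apply']; ring)
    (integrable_smear hf x ε τ) (fun p _ => hasLineDerivAt_weight p i) (fun p _ => by
      unfold HasLineDerivAt
      have h1 : HasDerivAt (fun h : ℝ => -√τ * h) (-√τ) 0 := by
        simpa using (hasDerivAt_id (0 : ℝ)).const_mul (-√τ)
      have h2 := HasDerivAt.scomp (0 : ℝ)
        (g₁ := fun h : ℝ => f (x - ε • p.1 - √τ • p.2 + h • EuclideanSpace.single i (1 : ℝ)))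
        (hf.hasDerivAt_line i (x - ε • p.1 - √τ • p.2) (-√τ * 0)) h1
      have h3 : ∀ h : ℝ, x - ε • (p + h • ((0 : Eucl d), EuclideanSpace.single i (1 : ℝ))).1
          - √τ • (p + h • ((0 : Eucl d), EuclideanSpace.single i (1 : ℝ))).2
          = x - ε • p.1 - √τ • p.2 + (-√τ * h) • EuclideanSpace.single i (1 : ℝ) := by
        intro h
        simp only [Prod.fst_add, Prod.snd_add, Prod.smul_fst, Prod.smul_snd, smul_zero, add_zero]
        module
      simp only [h3]
      refine h2.congr_deriv ?_
      simp)
  simp only [ContinuousLinearMap.mul_apply', ← Measure.volume_eq_prod] at key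
  have e1 : ∫ p : Eucl d × Eucl d, weight p * (-√τ * pderiv i f (x - ε • p.1 - √τ • p.2))
      = -√τ * smear (pderiv i f) x ε τ := by
    rw [smear, ← integral_const_mul]; congr 1; funext p; ring
  have e2 : ∫ p : Eucl d × Eucl d, -(p.2 i / 2) * weight p * f (x - ε • p.1 - √τ • p.2)
      = -(1 / 2) * ∫ p : Eucl d × Eucl d, weight p * (p.2 i * f (x - ε • p.1 - √τ • p.2)) := by
    rw [← integral_const_mul]; congr 1; funext p; ring
  rw [e1, e2] at key
  linarith

lemma fderiv_apply_eq_sum (hf : IsTest f) (x v : Eucl d) :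
    fderiv ℝ f x v = ∑ i, v i * pderiv i f x := by
  conv_lhs => rw [← (EuclideanSpace.basisFun (Fin d) ℝ).sum_repr v]
  rw [map_sum]
  refine Finset.sum_congr rfl fun i _ => ?_
  simp [hf.pderiv_eq]

/-- The heat equation, with the Laplacian placed on `f`. Differentiating √τ brings out -v / (2√τ);
integrating by parts against each ∂_i f trades v_i for -2√τ ∂_i, which cancels the singular factor.
-/
lemma hasDerivAt_smear_time (hf : IsTest f) (x : Eucl d) (ε : ℝ) {τ : ℝ} (hτ : 0 < τ) :
    HasDerivAt (fun τ => smear f x ε τ) (smear (laplacian f) x ε τ) τ := by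
  have hc := hf.continuous
  have hdc : Continuous (fderiv ℝ f) := hf.smooth.continuous_fderiv (by simp)
  obtain ⟨C, hC⟩ := (hf.hasCompactSupport.fderiv ℝ).exists_bound_of_continuous hdc
  have hC0 : 0 ≤ C := (norm_nonneg _).trans (hC 0)
  have hcpd : ∀ i, Continuous (pderiv i f) := fun i => (hf.pderiv i).continuous
  have hmain := (hasDerivAt_integral_of_dominated_loc_of_deriv_le (μ := volume)
    (F := fun τ (p : Eucl d × Eucl d) => weight p * f (x - ε • p.1 - √τ • p.2))
    (F' := fun τ (p : Eucl d × Eucl d) =>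
      weight p * fderiv ℝ f (x - ε • p.1 - √τ • p.2) (-((1 / (2 * √τ)) • p.2)))
    (s := Ioi (τ / 2)) (x₀ := τ)
    (bound := fun p => weight p * ‖p.2‖ * (C * (1 / (2 * √(τ / 2)))))
    (Ioi_mem_nhds (by linarith)) (Eventually.of_forall fun τ => by fun_prop)
    (integrable_smear hf x ε τ)
    (by fun_prop) (Eventually.of_forall fun p σ hσ => ?_)
    (integrable_weight_mul_norm.mul_const _)
    (Eventually.of_forall fun p σ hσ => ?_)).2
  · refine hmain.congr_deriv ?_
    have hsq : √τ ≠ 0 := (Real.sqrt_pos.2 hτ).ne'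
    have h1 : ∀ p : Eucl d × Eucl d,
        weight p * fderiv ℝ f (x - ε • p.1 - √τ • p.2) (-((1 / (2 * √τ)) • p.2))
        = ∑ i, -(1 / (2 * √τ)) * (weight p * (p.2 i * pderiv i f (x - ε • p.1 - √τ • p.2))) := by
      intro p
      rw [fderiv_apply_eq_sum hf, Finset.mul_sum]
      refine Finset.sum_congr rfl fun i _ => ?_
      simp; ring
    simp_rw [h1]
    rw [integral_finsetSum]
    · simp_rw [integral_const_mul, integral_weight_mul_coord (hf.pderiv _)]
      rw [smear]
      simp only [laplacian, Finset.mul_sum]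
      rw [integral_finsetSum _ fun i _ => integrable_smear ((hf.pderiv i).pderiv i) x ε τ]
      refine Finset.sum_congr rfl fun i _ => ?_
      rw [smear]
      field_simp
    · intro i _
      refine Integrable.const_mul ?_ _
      obtain ⟨K, hK0, hK⟩ := (hf.pderiv i).bounded
      refine (integrable_weight_mul_norm.mul_const K).mono' (by fun_prop)
        (Eventually.of_forall fun p => ?_)
      rw [norm_mul, norm_mul, Real.norm_of_nonneg (weight_pos p).le, mul_assoc]
      refine mul_le_mul_of_nonneg_left ?_ (weight_pos p).le
      exact mul_le_mul (PiLp.norm_apply_le p.2 i) (hK _) (norm_nonneg _) (norm_nonneg _)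
  · have hσ' : τ / 2 < σ := hσ
    have hs : √(τ / 2) ≤ √σ := Real.sqrt_le_sqrt hσ'.le
    have hs0 : 0 < √(τ / 2) := Real.sqrt_pos.2 (by linarith)
    rw [norm_mul, Real.norm_of_nonneg (weight_pos p).le, mul_assoc]
    refine mul_le_mul_of_nonneg_left ?_ (weight_pos p).le
    refine (ContinuousLinearMap.le_opNorm _ _).trans ?_
    rw [norm_neg, norm_smul, Real.norm_of_nonneg (by positivity)]
    calc _ ≤ C * (1 / (2 * √(τ / 2)) * ‖p.2‖) := by
          gcongr
          exact hC _
      _ = _ := by ring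
  · have hσ' : 0 < σ := lt_trans (by linarith) (show τ / 2 < σ from hσ)
    have h1 : HasDerivAt (fun σ => x - ε • p.1 - √σ • p.2) (-((1 / (2 * √σ)) • p.2)) σ :=
      ((Real.hasDerivAt_sqrt hσ'.ne').smul_const p.2).const_sub _
    exact ((hf.differentiable _).hasFDerivAt.comp_hasDerivAt σ h1).const_mul (weight p)

/-- A Chebyshev bound: `f` is nonzero at x - √τ v only if √τ ‖v‖ ≥ 1, so the integrand may be
multiplied by (√τ ‖v‖)⁴. The power τ² suffices because it beats the factor τ^(-3/2) met later. -/
lemma abs_smear_zero_le (hf : IsTest f) {x : Eucl d} (hx : 2 < ‖x‖) :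
    ∃ C, 0 ≤ C ∧ ∀ τ, 0 ≤ τ → |smear f x 0 τ| ≤ C * τ ^ 2 := by
  obtain ⟨C, hC0, hC⟩ := hf.bounded
  refine ⟨(∫ p : Eucl d × Eucl d, weight p * ‖p.2‖ ^ 4) * C,
    mul_nonneg (integral_nonneg fun p => mul_nonneg (weight_pos p).le (by positivity)) hC0,
    fun τ hτ => ?_⟩
  rw [mul_assoc, ← integral_mul_const, ← Real.norm_eq_abs, smear]
  refine norm_integral_le_of_norm_le (integrable_weight_mul_norm_pow_four.mul_const _)
    (Eventually.of_forall fun p => ?_)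
  rw [norm_mul, Real.norm_of_nonneg (weight_pos p).le, mul_assoc]
  refine mul_le_mul_of_nonneg_left ?_ (weight_pos p).le
  rw [zero_smul, sub_zero]
  rcases le_or_gt 1 ‖x - √τ • p.2‖ with h | h
  · rw [hf.eq_zero h, norm_zero]; positivity
  · have h1 : 1 ≤ √τ * ‖p.2‖ := by
      have := norm_sub_norm_le x (√τ • p.2)
      rw [norm_smul, Real.norm_of_nonneg (Real.sqrt_nonneg _)] at this
      linarith
    have h2 : 1 ≤ (√τ * ‖p.2‖) ^ 4 := one_le_pow₀ h1
    have h3 : √τ ^ 4 = τ ^ 2 := by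
      rw [show √τ ^ 4 = (√τ ^ 2) ^ 2 by ring, Real.sq_sqrt hτ]
    rw [mul_pow, h3] at h2
    have := mul_le_mul_of_nonneg_right h2 hC0
    refine (hC _).trans ?_
    nlinarith

end Smear

/-! ### Time convolutions with weakly singular kernels -/

lemma intervalIntegrable_conv {φ k : ℝ → ℝ} {r C : ℝ} (hr : 0 ≤ r)
    (hφ : ContinuousOn φ (Icc 0 r)) (hk : ContinuousOn k (Ioi 0))
    (hC : ∀ τ ∈ Ioc 0 r, |k τ| ≤ C * τ ^ (-(1 / 2) : ℝ)) :
    IntervalIntegrable (fun s => φ s * k (r - s)) volume 0 r := by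
  have h1 : IntervalIntegrable (fun τ => τ ^ (-(1 / 2) : ℝ)) volume 0 r :=
    intervalIntegral.intervalIntegrable_rpow' (by norm_num)
  have h2 : IntervalIntegrable k volume 0 r := by
    refine (h1.const_mul C).mono_fun ?_ ?_
    · rw [uIoc_of_le hr]
      exact (hk.mono fun x hx => hx.1).aestronglyMeasurable measurableSet_Ioc
    · rw [uIoc_of_le hr]
      refine (ae_restrict_iff' measurableSet_Ioc).2 (Eventually.of_forall fun τ hτ => ?_)
      exact (hC τ hτ).trans (le_abs_self _)
  have h3 : IntervalIntegrable (fun s => k (r - s)) volume 0 r := by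
    have := h2.comp_sub_left r
    simpa using this.symm
  exact h3.continuousOn_mul (by rwa [uIcc_of_le hr])

/-- Since κ vanishes on τ ≤ 0, the moving endpoint can be replaced by a fixed T > t. Only the kernel
is then differentiated, and continuity of φ is enough. -/
lemma hasDerivAt_conv_of_smooth {φ κ κ' : ℝ → ℝ} {t : ℝ} (hφ : ContinuousOn φ (Ico 0 2))
    (ht : t ∈ Ioo (0 : ℝ) 2) (hκ : ∀ τ, HasDerivAt κ (κ' τ) τ) (hκ' : Continuous κ')
    (h0 : ∀ τ ≤ 0, κ τ = 0) :
    HasDerivAt (fun r => ∫ s in (0 : ℝ)..r, φ s * κ (r - s))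
      (∫ s in (0 : ℝ)..t, φ s * κ' (t - s)) t := by
  -- T stays below 2 so that φ is continuous, hence bounded, on [0, T].
  obtain ⟨T, htT, hT2⟩ := exists_between ht.2
  have hT0 : 0 < T := ht.1.trans htT
  have hκc : Continuous κ := continuous_iff_continuousAt.2 fun τ => (hκ τ).continuousAt
  have hφT : ContinuousOn φ (uIcc 0 T) := by
    rw [uIcc_of_le hT0.le]; exact hφ.mono fun x hx => ⟨hx.1, hx.2.trans_lt hT2⟩
  have hint : ∀ (g : ℝ → ℝ), Continuous g → ∀ r,
      IntervalIntegrable (fun s => φ s * g (r - s)) volume 0 T := fun g hg r =>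
    (hφT.mul (by fun_prop)).intervalIntegrable
  have hext : ∀ (g : ℝ → ℝ), Continuous g → (∀ τ < 0, g τ = 0) → ∀ r ∈ Icc 0 T,
      ∫ s in (0 : ℝ)..r, φ s * g (r - s) = ∫ s in (0 : ℝ)..T, φ s * g (r - s) := by
    intro g hg hg0 r hr
    have hz : ∫ s in r..T, φ s * g (r - s) = 0 := by
      refine intervalIntegral.integral_zero_ae (Eventually.of_forall fun s hs => ?_)
      rw [uIoc_of_le hr.2] at hs
      rw [hg0 _ (by linarith [hs.1]), mul_zero]
    rw [← intervalIntegral.integral_add_adjacent_intervals (b := r) (c := T)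
      ((hint g hg r).mono_set ?_) ((hint g hg r).mono_set ?_), hz, add_zero]
    · rw [uIcc_of_le hr.1, uIcc_of_le hT0.le]; exact Icc_subset_Icc_right hr.2
    · rw [uIcc_of_le hr.2, uIcc_of_le hT0.le]; exact Icc_subset_Icc_left hr.1
  have hκ'0 : ∀ τ < 0, κ' τ = 0 := by
    intro τ hτ
    refine (hκ τ).unique ((hasDerivAt_const τ (0 : ℝ)).congr_of_eventuallyEq ?_)
    filter_upwards [Iio_mem_nhds hτ] with σ hσ
    exact h0 σ (le_of_lt hσ)
  rw [hext κ' hκ' hκ'0 t ⟨ht.1.le, htT.le⟩]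
  obtain ⟨A, hA⟩ := isCompact_uIcc.exists_bound_of_continuousOn hφT
  obtain ⟨B, hB⟩ := (isCompact_Icc (a := (-2 : ℝ)) (b := 2)).exists_bound_of_continuousOn
    hκ'.continuousOn
  have hder := (intervalIntegral.hasDerivAt_integral_of_dominated_loc_of_deriv_le
    (μ := volume) (a := 0) (b := T) (x₀ := t) (s := Ioo 0 2) (bound := fun _ => A * B)
    (F := fun r s => φ s * κ (r - s)) (F' := fun r s => φ s * κ' (r - s))
    (Ioo_mem_nhds ht.1 ht.2)
    (Eventually.of_forall fun r => (hint κ hκc r).def'.aestronglyMeasurable) (hint κ hκc t)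
    (hint κ' hκ' t).def'.aestronglyMeasurable
    (Eventually.of_forall fun s hs r hr => ?_) intervalIntegrable_const
    (Eventually.of_forall fun s hs r hr => ?_)).2
  · refine hder.congr_of_eventuallyEq ?_
    filter_upwards [Ioo_mem_nhds ht.1 htT] with r hr
    exact hext κ hκc (fun τ hτ => h0 τ hτ.le) r ⟨hr.1.le, hr.2.le⟩
  · rw [norm_mul]
    have hs' := hs
    rw [uIoc_of_le hT0.le] at hs'
    exact mul_le_mul (hA s (uIoc_subset_uIcc hs))
      (hB _ ⟨by linarith [hs'.2, hr.1], by linarith [hs'.1, hr.2]⟩) (norm_nonneg _)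
      ((norm_nonneg _).trans (hA s (uIoc_subset_uIcc hs)))
  · have h1 : HasDerivAt (fun r => κ (r - s)) (κ' (r - s)) r := by
      simpa using (hκ (r - s)).comp_sub_const r s
    exact h1.const_mul (φ s)

/-- In the variable τ = r - s a kernel vanishing beyond δ gives an integral over the fixed interval
[0, δ]. The derivative falls on φ(r - τ), which involves φ only near t, and the kernel may keep its
singularity τ^(-1/2). -/
lemma hasDerivAt_conv_of_near {φ φ' k : ℝ → ℝ} {t δ C : ℝ} (hδ : 0 < δ) (hδt : 2 * δ < t)
    (hφ : ContinuousOn φ (Icc 0 (t + 2 * δ)))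
    (hφd : ∀ u ∈ Icc (t - 2 * δ) (t + 2 * δ), HasDerivAt φ (φ' u) u)
    (hφ' : ContinuousOn φ' (Icc (t - 2 * δ) (t + 2 * δ))) (hk : ContinuousOn k (Ioi 0))
    (hC : ∀ τ ∈ Ioc 0 (t + δ), |k τ| ≤ C * τ ^ (-(1 / 2) : ℝ)) (hk0 : ∀ τ, δ ≤ τ → k τ = 0) :
    HasDerivAt (fun r => ∫ s in (0 : ℝ)..r, φ s * k (r - s))
      (∫ τ in (0 : ℝ)..δ, φ' (t - τ) * k τ) t := by
  have hr_int : ∀ r ∈ Ioo (t - δ) (t + δ),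
      IntervalIntegrable (fun τ => φ (r - τ) * k τ) volume 0 r := by
    intro r hr
    have h1 := intervalIntegrable_conv (r := r) (C := C) (by linarith [hr.1])
      (hφ.mono (Icc_subset_Icc_right (by linarith [hr.2]))) hk
      (fun τ hτ => hC τ ⟨hτ.1, hτ.2.trans hr.2.le⟩)
    have := (h1.comp_sub_left r).symm
    simpa using this
  have hδ_int : ∀ r ∈ Ioo (t - δ) (t + δ),
      IntervalIntegrable (fun τ => φ (r - τ) * k τ) volume 0 δ := by
    intro r hr
    refine (hr_int r hr).mono_set ?_
    rw [uIcc_of_le hδ.le, uIcc_of_le (by linarith [hr.1])]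
    exact Icc_subset_Icc_right (by linarith [hr.1])
  have heq : ∀ r ∈ Ioo (t - δ) (t + δ), ∫ s in (0 : ℝ)..r, φ s * k (r - s)
      = ∫ τ in (0 : ℝ)..δ, φ (r - τ) * k τ := by
    intro r hr
    have h1 := intervalIntegral.integral_comp_sub_left (a := 0) (b := r)
      (fun τ => φ (r - τ) * k τ) r
    simp only [sub_sub_cancel, sub_self, sub_zero] at h1
    rw [h1, ← intervalIntegral.integral_add_adjacent_intervals (b := δ) (hδ_int r hr)
      ((hr_int r hr).mono_set ?_)]
    · rw [intervalIntegral.integral_zero_ae (a := δ), add_zero]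
      refine Eventually.of_forall fun τ hτ => ?_
      rw [uIoc_of_le (by linarith [hr.1])] at hτ
      rw [hk0 τ hτ.1.le, mul_zero]
    · rw [uIcc_of_le (by linarith [hr.1]), uIcc_of_le (by linarith [hr.1])]
      exact Icc_subset_Icc_left hδ.le
  obtain ⟨B, hB⟩ := isCompact_Icc.exists_bound_of_continuousOn hφ'
  have ht_mem : t ∈ Ioo (t - δ) (t + δ) := ⟨by linarith, by linarith⟩
  have hnhds : Ioo (t - δ) (t + δ) ∈ 𝓝 t := Ioo_mem_nhds ht_mem.1 ht_mem.2
  have hsub : ∀ r ∈ Ioo (t - δ) (t + δ), ∀ τ ∈ Ioc 0 δ, r - τ ∈ Icc (t - 2 * δ) (t + 2 * δ) :=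
    fun r hr τ hτ => ⟨by linarith [hr.1, hτ.2], by linarith [hr.2, hτ.1]⟩
  have h1 : IntervalIntegrable (fun τ => τ ^ (-(1 / 2) : ℝ)) volume 0 δ :=
    intervalIntegral.intervalIntegrable_rpow' (by norm_num)
  have hder := (intervalIntegral.hasDerivAt_integral_of_dominated_loc_of_deriv_le
    (μ := volume) (a := 0) (b := δ) (x₀ := t) (s := Ioo (t - δ) (t + δ))
    (bound := fun τ => B * (C * τ ^ (-(1 / 2) : ℝ)))
    (F := fun r τ => φ (r - τ) * k τ) (F' := fun r τ => φ' (r - τ) * k τ) hnhds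
    (by filter_upwards [hnhds] with r hr using (hδ_int r hr).def'.aestronglyMeasurable)
    (hδ_int t ht_mem) ?_
    (Eventually.of_forall fun τ hτ r hr => ?_) ((h1.const_mul C).const_mul B)
    (Eventually.of_forall fun τ hτ r hr => ?_)).2
  · refine hder.congr_of_eventuallyEq ?_
    filter_upwards [hnhds] with r hr using heq r hr
  · rw [uIoc_of_le hδ.le]
    refine ContinuousOn.aestronglyMeasurable (ContinuousOn.mul ?_ (hk.mono fun x hx => hx.1))
      measurableSet_Ioc
    exact hφ'.comp (by fun_prop) fun τ hτ => hsub t ht_mem τ hτ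
  · rw [uIoc_of_le hδ.le] at hτ
    rw [norm_mul]
    have hb := hB _ (hsub r hr τ hτ)
    exact mul_le_mul hb (hC τ ⟨hτ.1, by linarith [hτ.2]⟩) (norm_nonneg _)
      ((norm_nonneg _).trans hb)
  · rw [uIoc_of_le hδ.le] at hτ
    have h2 : HasDerivAt (fun r => φ (r - τ)) (φ' (r - τ)) r := by
      simpa using (hφd _ (hsub r hr τ hτ)).comp_sub_const r τ
    exact h2.mul_const (k τ)

/-- A smooth cutoff which is `1` for `τ ≤ δ / 2` and `0` for `τ ≥ δ`. -/
def timeCutoff (δ τ : ℝ) : ℝ := Real.smoothTransition (2 - 2 * τ / δ)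

section Cutoff

variable {δ : ℝ}

lemma contDiff_timeCutoff : ContDiff ℝ ∞ (timeCutoff δ) := by
  unfold timeCutoff
  exact Real.smoothTransition.contDiff.comp (by fun_prop)

lemma timeCutoff_of_le (hδ : 0 < δ) {τ : ℝ} (h : τ ≤ δ / 2) : timeCutoff δ τ = 1 := by
  refine Real.smoothTransition.one_of_one_le ?_
  have : 2 * τ / δ ≤ 1 := by rw [div_le_one hδ]; linarith
  linarith

lemma timeCutoff_of_ge (hδ : 0 < δ) {τ : ℝ} (h : δ ≤ τ) : timeCutoff δ τ = 0 := by
  refine Real.smoothTransition.zero_of_nonpos ?_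
  have : 2 ≤ 2 * τ / δ := by rw [le_div_iff₀ hδ]; linarith
  linarith

lemma timeCutoff_nonneg (τ : ℝ) : 0 ≤ timeCutoff δ τ := Real.smoothTransition.nonneg _

lemma timeCutoff_le_one (τ : ℝ) : timeCutoff δ τ ≤ 1 := Real.smoothTransition.le_one _

lemma continuous_timeCutoff : Continuous (timeCutoff δ) := contDiff_timeCutoff.continuous

lemma continuous_deriv_timeCutoff : Continuous (deriv (timeCutoff δ)) :=
  contDiff_timeCutoff.continuous_deriv (by simp)

lemma hasDerivAt_timeCutoff (τ : ℝ) :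
    HasDerivAt (timeCutoff δ) (deriv (timeCutoff δ) τ) τ :=
  (contDiff_timeCutoff.differentiable (by simp) τ).hasDerivAt

lemma deriv_timeCutoff_of_lt (hδ : 0 < δ) {τ : ℝ} (h : τ < δ / 2) :
    deriv (timeCutoff δ) τ = 0 := by
  have : timeCutoff δ =ᶠ[𝓝 τ] fun _ => 1 := by
    filter_upwards [Iio_mem_nhds h] with σ hσ using timeCutoff_of_le hδ (le_of_lt hσ)
  rw [this.deriv_eq]; simp

/-- The derivative of `(1 - χ) k`, `χ` the cutoff. -/
def farDeriv (δ : ℝ) (k k' : ℝ → ℝ) (τ : ℝ) : ℝ :=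
  -deriv (timeCutoff δ) τ * k τ + (1 - timeCutoff δ τ) * k' τ

lemma farDeriv_of_lt (hδ : 0 < δ) (k k' : ℝ → ℝ) {τ : ℝ} (h : τ < δ / 2) :
    farDeriv δ k k' τ = 0 := by
  rw [farDeriv, deriv_timeCutoff_of_lt hδ h, timeCutoff_of_le hδ h.le]; ring

/-- The cutoff product is identically zero for τ ≤ δ/2, so the values of `k` at τ ≤ 0 do not matter
and the derivative exists on the whole line. -/
lemma hasDerivAt_far (hδ : 0 < δ) {k k' : ℝ → ℝ} (hk : ∀ τ, 0 < τ → HasDerivAt k (k' τ) τ)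
    (τ : ℝ) :
    HasDerivAt (fun τ => (1 - timeCutoff δ τ) * k τ) (farDeriv δ k k' τ) τ := by
  rcases lt_or_ge 0 τ with h | h
  · exact ((hasDerivAt_timeCutoff τ).const_sub 1).mul (hk τ h)
  · have hlt : τ < δ / 2 := by linarith
    rw [farDeriv_of_lt hδ k k' hlt]
    refine (hasDerivAt_const τ (0 : ℝ)).congr_of_eventuallyEq ?_
    filter_upwards [Iio_mem_nhds hlt] with σ hσ
    rw [timeCutoff_of_le hδ (le_of_lt hσ)]; ring

lemma continuous_farDeriv (hδ : 0 < δ) {k k' : ℝ → ℝ} (hk : ContinuousOn k (Ioi 0))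
    (hk' : ContinuousOn k' (Ioi 0)) : Continuous (farDeriv δ k k') := by
  refine continuous_iff_continuousAt.2 fun τ => ?_
  rcases lt_or_ge 0 τ with h | h
  · have h1 := hk.continuousAt (Ioi_mem_nhds h)
    have h2 := hk'.continuousAt (Ioi_mem_nhds h)
    exact (continuous_deriv_timeCutoff.continuousAt.neg.mul h1).add
      ((continuousAt_const.sub continuous_timeCutoff.continuousAt).mul h2)
  · have hlt : τ < δ / 2 := by linarith
    refine (continuousAt_const (y := (0 : ℝ))).congr ?_
    filter_upwards [Iio_mem_nhds hlt] with σ hσ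
    exact (farDeriv_of_lt hδ k k' hσ).symm

lemma abs_timeCutoff_mul_le {k : ℝ → ℝ} (τ : ℝ) : |timeCutoff δ τ * k τ| ≤ |k τ| := by
  rw [abs_mul, abs_of_nonneg (timeCutoff_nonneg τ)]
  exact mul_le_of_le_one_left (abs_nonneg _) (timeCutoff_le_one τ)

lemma abs_one_sub_timeCutoff_mul_le {k : ℝ → ℝ} (τ : ℝ) :
    |(1 - timeCutoff δ τ) * k τ| ≤ |k τ| := by
  rw [abs_mul, abs_of_nonneg (by linarith [timeCutoff_le_one (δ := δ) τ])]
  exact mul_le_of_le_one_left (abs_nonneg _) (by linarith [timeCutoff_nonneg (δ := δ) τ])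

end Cutoff

/-! ### Time derivatives of singular convolutions and their limits -/

/-- Neither factor can take the derivative on all of (0, t): `k'` need not be integrable at 0, and φ
is differentiable only near t. The cutoff splits the kernel so that φ is differentiated for small τ
and the kernel for the other τ. -/
lemma hasDerivAt_conv {φ φ' k k' : ℝ → ℝ} {t δ C : ℝ} (hδ : 0 < δ) (hδt : 2 * δ < t)
    (hδ2 : t + 2 * δ < 2) (hφ : ContinuousOn φ (Ico 0 2))
    (hφd : ∀ u ∈ Icc (t - 2 * δ) (t + 2 * δ), HasDerivAt φ (φ' u) u)
    (hφ' : ContinuousOn φ' (Icc (t - 2 * δ) (t + 2 * δ)))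
    (hk : ∀ τ, 0 < τ → HasDerivAt k (k' τ) τ) (hk' : ContinuousOn k' (Ioi 0))
    (hC : ∀ τ ∈ Ioo (0 : ℝ) 2, |k τ| ≤ C * τ ^ (-(1 / 2) : ℝ)) :
    HasDerivAt (fun r => ∫ s in (0 : ℝ)..r, φ s * k (r - s))
      ((∫ τ in (0 : ℝ)..δ, φ' (t - τ) * (timeCutoff δ τ * k τ))
        + ∫ s in (0 : ℝ)..t, φ s * farDeriv δ k k' (t - s)) t := by
  have hkc : ContinuousOn k (Ioi 0) := fun τ hτ => (hk τ hτ).continuousAt.continuousWithinAt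
  have h1 := hasDerivAt_conv_of_near (k := fun τ => timeCutoff δ τ * k τ) (C := C) hδ hδt
    (hφ.mono fun u hu => ⟨hu.1, hu.2.trans_lt hδ2⟩) hφd hφ'
    (continuous_timeCutoff.continuousOn.mul hkc)
    (fun τ hτ => (abs_timeCutoff_mul_le τ).trans (hC τ ⟨hτ.1, by linarith [hτ.2]⟩))
    (fun τ hτ => by rw [timeCutoff_of_ge hδ hτ, zero_mul])
  have h2 := hasDerivAt_conv_of_smooth (t := t) hφ ⟨by linarith, by linarith⟩
    (hasDerivAt_far hδ hk) (continuous_farDeriv hδ hkc hk')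
    (fun τ hτ => by rw [timeCutoff_of_le hδ (by linarith)]; ring)
  refine (h1.add h2).congr_of_eventuallyEq ?_
  filter_upwards [Ioo_mem_nhds (show 0 < t by linarith) (show t < 2 by linarith)] with r hr
  have hφr : ContinuousOn φ (Icc 0 r) := hφ.mono fun u hu => ⟨hu.1, hu.2.trans_lt hr.2⟩
  have hCr : ∀ τ ∈ Ioc 0 r, |k τ| ≤ C * τ ^ (-(1 / 2) : ℝ) :=
    fun τ hτ => hC τ ⟨hτ.1, hτ.2.trans_lt hr.2⟩
  simp only [Pi.add_apply]
  rw [← intervalIntegral.integral_add]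
  · congr 1; funext s; ring
  · exact intervalIntegrable_conv (k := fun τ => timeCutoff δ τ * k τ) hr.1.le hφr
      (continuous_timeCutoff.continuousOn.mul hkc)
      (fun τ hτ => (abs_timeCutoff_mul_le τ).trans (hCr τ hτ))
  · exact intervalIntegrable_conv (k := fun τ => (1 - timeCutoff δ τ) * k τ) hr.1.le hφr
      ((continuous_const.sub continuous_timeCutoff).continuousOn.mul hkc)
      (fun τ hτ => (abs_one_sub_timeCutoff_mul_le τ).trans (hCr τ hτ))

/-- Both pieces of the split derivative converge by dominated convergence with bounds uniform in ε.
The limit kernel extends by zero to a C¹ function κ, so the limit has a form without cutoff and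
without φ'. -/
lemma tendsto_deriv_conv {φ φ' : ℝ → ℝ} {k k' : ℝ → ℝ → ℝ} {κ κ' : ℝ → ℝ} {t δ C C' : ℝ}
    (hδ : 0 < δ) (hδt : 2 * δ < t)
    (hδ2 : t + 2 * δ < 2) (hφ : ContinuousOn φ (Ico 0 2))
    (hφd : ∀ u ∈ Icc (t - 2 * δ) (t + 2 * δ), HasDerivAt φ (φ' u) u)
    (hφ' : ContinuousOn φ' (Icc (t - 2 * δ) (t + 2 * δ)))
    (hk : ∀ ε τ, 0 < τ → HasDerivAt (k ε) (k' ε τ) τ) (hk' : ∀ ε, ContinuousOn (k' ε) (Ioi 0))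
    (hC : ∀ ε, ∀ τ ∈ Ioo (0 : ℝ) 2, |k ε τ| ≤ C * τ ^ (-(1 / 2) : ℝ))
    (hC' : ∀ ε, ∀ τ ∈ Ico (δ / 2) 2, |k' ε τ| ≤ C')
    (hlim : ∀ τ, 0 < τ → Tendsto (fun ε => k ε τ) (𝓝[>] 0) (𝓝 (k 0 τ)))
    (hlim' : ∀ τ, 0 < τ → Tendsto (fun ε => k' ε τ) (𝓝[>] 0) (𝓝 (k' 0 τ)))
    (hκ : ∀ τ, HasDerivAt κ (κ' τ) τ) (hκ' : Continuous κ') (hκ0 : ∀ τ ≤ 0, κ τ = 0)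
    (hκk : ∀ τ, 0 < τ → κ τ = k 0 τ) :
    Tendsto (fun ε => deriv (fun r => ∫ s in (0 : ℝ)..r, φ s * k ε (r - s)) t) (𝓝[>] 0)
      (𝓝 (∫ s in (0 : ℝ)..t, φ s * κ' (t - s))) := by
  have ht0 : 0 < t := by linarith
  have hD := fun ε => hasDerivAt_conv hδ hδt hδ2 hφ hφd hφ' (hk ε) (hk' ε) (hC ε)
  have hkc : ∀ ε, ContinuousOn (k ε) (Ioi 0) :=
    fun ε τ hτ => (hk ε τ hτ).continuousAt.continuousWithinAt
  -- The split and unsplit expressions are derivatives of one function, the convolution at ε = 0, so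
  -- they agree by uniqueness.
  have hval : (∫ s in (0 : ℝ)..t, φ s * κ' (t - s))
      = (∫ τ in (0 : ℝ)..δ, φ' (t - τ) * (timeCutoff δ τ * k 0 τ))
        + ∫ s in (0 : ℝ)..t, φ s * farDeriv δ (k 0) (k' 0) (t - s) := by
    have h1 := hasDerivAt_conv_of_smooth (t := t) hφ ⟨ht0, by linarith⟩ hκ hκ' hκ0
    refine h1.unique ((hD 0).congr_of_eventuallyEq ?_)
    filter_upwards [Ioi_mem_nhds ht0] with r hr
    refine intervalIntegral.integral_congr_ae ?_
    filter_upwards [Measure.ae_ne volume r] with s hs hsr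
    rw [uIoc_of_le (le_of_lt hr)] at hsr
    rw [hκk _ (sub_pos.2 (lt_of_le_of_ne hsr.2 hs))]
  rw [hval]
  simp_rw [fun ε => (hD ε).deriv]
  obtain ⟨A, hA⟩ := isCompact_Icc.exists_bound_of_continuousOn
    (hφ.mono (show Icc 0 t ⊆ Ico 0 2 from fun u hu => ⟨hu.1, by linarith [hu.2]⟩))
  obtain ⟨B, hB⟩ := isCompact_Icc.exists_bound_of_continuousOn hφ'
  obtain ⟨X, hX⟩ := (isCompact_Icc (a := (0 : ℝ)) (b := 2)).exists_bound_of_continuousOn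
    (continuous_deriv_timeCutoff (δ := δ)).continuousOn
  have hX0 : 0 ≤ X := (norm_nonneg _).trans (hX 0 (by norm_num))
  have hC0 : 0 ≤ C := by
    have := (abs_nonneg _).trans (hC 0 1 (by norm_num))
    simpa using this
  have hC'0 : 0 ≤ C' := (abs_nonneg _).trans (hC' 0 (δ / 2) ⟨le_rfl, by linarith⟩)
  refine Tendsto.add ?_ ?_
  · have h1 : IntervalIntegrable (fun τ => τ ^ (-(1 / 2) : ℝ)) volume 0 δ :=
      intervalIntegral.intervalIntegrable_rpow' (by norm_num)
    have hsub : ∀ τ ∈ Ioc 0 δ, t - τ ∈ Icc (t - 2 * δ) (t + 2 * δ) :=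
      fun τ hτ => ⟨by linarith [hτ.2], by linarith [hτ.1]⟩
    refine intervalIntegral.tendsto_integral_filter_of_dominated_convergence
      (fun τ => B * (C * τ ^ (-(1 / 2) : ℝ))) (Eventually.of_forall fun ε => ?_)
      (Eventually.of_forall fun ε => Eventually.of_forall fun τ hτ => ?_)
      ((h1.const_mul C).const_mul B) (Eventually.of_forall fun τ hτ => ?_)
    · rw [uIoc_of_le hδ.le]
      refine ContinuousOn.aestronglyMeasurable (ContinuousOn.mul ?_
        (continuous_timeCutoff.continuousOn.mul ((hkc ε).mono fun x hx => hx.1)))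
        measurableSet_Ioc
      exact hφ'.comp (by fun_prop) hsub
    · rw [uIoc_of_le hδ.le] at hτ
      rw [norm_mul]
      have hb := hB _ (hsub τ hτ)
      exact mul_le_mul hb ((abs_timeCutoff_mul_le τ).trans
        (hC ε τ ⟨hτ.1, by linarith [hτ.2]⟩)) (norm_nonneg _) ((norm_nonneg _).trans hb)
    · rw [uIoc_of_le hδ.le] at hτ
      exact ((hlim τ hτ.1).const_mul _).const_mul _
  · refine intervalIntegral.tendsto_integral_filter_of_dominated_convergence
      (fun _ => A * (X * (C * (δ / 2) ^ (-(1 / 2) : ℝ)) + C'))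
      (Eventually.of_forall fun ε => ?_)
      (Eventually.of_forall fun ε => Eventually.of_forall fun s hs => ?_)
      intervalIntegrable_const ?_
    · rw [uIoc_of_le ht0.le]
      refine ContinuousOn.aestronglyMeasurable (ContinuousOn.mul
        (hφ.mono fun u hu => ⟨hu.1.le, by linarith [hu.2]⟩)
        ((continuous_farDeriv hδ (hkc ε) (hk' ε)).comp (by fun_prop)).continuousOn)
        measurableSet_Ioc
    · rw [uIoc_of_le ht0.le] at hs
      have ha := hA s ⟨hs.1.le, hs.2⟩
      rw [norm_mul]
      refine mul_le_mul ha ?_ (norm_nonneg _) ((norm_nonneg _).trans ha)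
      rcases lt_or_ge (t - s) (δ / 2) with h | h
      · rw [farDeriv_of_lt hδ _ _ h, norm_zero]; positivity
      · have hτ2 : t - s < 2 := by linarith [hs.1]
        refine (norm_add_le _ _).trans (add_le_add ?_ ?_)
        · rw [norm_mul, norm_neg]
          refine mul_le_mul (hX _ ⟨by linarith, hτ2.le⟩) ?_ (norm_nonneg _) hX0
          refine (hC ε _ ⟨by linarith, hτ2⟩).trans (mul_le_mul_of_nonneg_left ?_ hC0)
          exact Real.rpow_le_rpow_of_nonpos (by linarith) h (by norm_num)
        · exact (abs_one_sub_timeCutoff_mul_le (k := k' ε) _).trans (hC' ε _ ⟨h, hτ2⟩)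
    · filter_upwards [Measure.ae_ne volume t] with s hst hs
      rw [uIoc_of_le ht0.le] at hs
      have hpos : 0 < t - s := sub_pos.2 (lt_of_le_of_ne hs.2 hst)
      exact (((hlim _ hpos).const_mul _).add ((hlim' _ hpos).const_mul _)).const_mul _

/-! ### The heat potential as a time convolution -/

section Scaling

variable {d : ℕ}

lemma integral_gaussWeight_mul_comp (f : Eucl d → ℝ) (X : Eucl d) {τ : ℝ} (hτ : 0 < τ) :
    ∫ v : Eucl d, gaussWeight v * f (X - √τ • v)
      = τ ^ (-(d : ℝ) / 2) * ∫ z : Eucl d, f z * Real.exp (-‖X - z‖ ^ 2 / (4 * τ)) := by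
  have hs : 0 < √τ := Real.sqrt_pos.2 hτ
  have h1 := Measure.integral_comp_smul (volume : Measure (Eucl d))
    (fun u => f (X - u) * Real.exp (-‖u‖ ^ 2 / (4 * τ))) √τ
  have h2 := integral_sub_left_eq_self
    (fun u : Eucl d => f (X - u) * Real.exp (-‖u‖ ^ 2 / (4 * τ))) volume X
  simp only [sub_sub_cancel] at h2
  rw [← h2] at h1
  have h3 : |(√τ ^ Module.finrank ℝ (Eucl d))⁻¹| = τ ^ (-(d : ℝ) / 2) := by
    rw [abs_of_nonneg (by positivity), finrank_euclideanSpace_fin, Real.sqrt_eq_rpow,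
      ← Real.rpow_natCast, ← Real.rpow_mul hτ.le, ← Real.rpow_neg hτ.le]
    congr 1; ring
  rw [h3, smul_eq_mul] at h1
  rw [← h1]
  congr 1; funext v
  rw [norm_smul, Real.norm_of_nonneg hs.le, mul_pow, Real.sq_sqrt hτ.le, gaussWeight, mul_comm]
  congr 2
  field_simp

lemma integral_poissonWeight_mul_comp (H : Eucl d → ℝ) {ε : ℝ} (hε : 0 < ε) :
    ∫ y : Eucl d, poissonWeight y * H (ε • y)
      = ∫ y : Eucl d, ε * (‖y‖ ^ 2 + ε ^ 2) ^ (-((d : ℝ) + 1) / 2) * H y := by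
  have h1 := Measure.integral_comp_smul (volume : Measure (Eucl d))
    (fun y => ε * (‖y‖ ^ 2 + ε ^ 2) ^ (-((d : ℝ) + 1) / 2) * H y) ε
  rw [abs_of_nonneg (by positivity), finrank_euclideanSpace_fin, smul_eq_mul] at h1
  have h2 : ∫ y : Eucl d, ε * (‖ε • y‖ ^ 2 + ε ^ 2) ^ (-((d : ℝ) + 1) / 2) * H (ε • y)
      = (ε ^ d)⁻¹ * ∫ y : Eucl d, poissonWeight y * H (ε • y) := by
    rw [← integral_const_mul]
    congr 1; funext y
    rw [norm_smul, Real.norm_of_nonneg hε.le, mul_pow,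
      show ε ^ 2 * ‖y‖ ^ 2 + ε ^ 2 = ε ^ 2 * (1 + ‖y‖ ^ 2) by ring,
      Real.mul_rpow (by positivity) (by positivity), ← Real.rpow_natCast ε 2,
      ← Real.rpow_mul hε.le, poissonWeight,
      show ((2 : ℕ) : ℝ) * (-((d : ℝ) + 1) / 2) = -((d + 1 : ℕ) : ℝ) by push_cast; ring,
      Real.rpow_neg hε.le, Real.rpow_natCast]
    have : ε ^ d ≠ 0 := by positivity
    field_simp
    ring
  rw [h2] at h1
  have h3 : (ε ^ d)⁻¹ ≠ 0 := by positivity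
  exact mul_left_cancel₀ h3 h1

lemma IsTest.integrable {f : Eucl d → ℝ} (hf : IsTest f) : Integrable f :=
  hf.continuous.integrable_of_hasCompactSupport hf.hasCompactSupport

/-- Undoing both rescalings and applying Fubini gives the order of integration used in
`heatPotential`. -/
lemma smear_eq {f : Eucl d → ℝ} (hf : IsTest f) (x : Eucl d) {ε τ : ℝ} (hε : 0 < ε)
    (hτ : 0 < τ) :
    smear f x ε τ = τ ^ (-(d : ℝ) / 2) * ∫ z : Eucl d, f z *
      ∫ y : Eucl d, ε * (‖y‖ ^ 2 + ε ^ 2) ^ (-((d : ℝ) + 1) / 2)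
        * Real.exp (-‖x - y - z‖ ^ 2 / (4 * τ)) := by
  have hfc := hf.continuous
  have h1 : smear f x ε τ = ∫ y : Eucl d, poissonWeight y *
      (τ ^ (-(d : ℝ) / 2) * ∫ z : Eucl d, f z * Real.exp (-‖x - ε • y - z‖ ^ 2 / (4 * τ))) := by
    rw [smear, Measure.volume_eq_prod, integral_prod _ (integrable_smear hf x ε τ)]
    congr 1; funext y
    rw [← integral_gaussWeight_mul_comp f _ hτ, ← integral_const_mul]
    simp only [weight, mul_assoc]
  have hswap := integral_integral_swap (μ := (volume : Measure (Eucl d)))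
    (ν := (volume : Measure (Eucl d)))
    (f := fun y z => poissonWeight y * (f z * Real.exp (-‖x - ε • y - z‖ ^ 2 / (4 * τ)))) (by
      refine (integrable_poissonWeight.mul_prod hf.integrable.norm).mono' ?_ ?_
      · exact Continuous.aestronglyMeasurable (by unfold Function.uncurry; fun_prop)
      · refine Eventually.of_forall fun p => ?_
        simp only [Function.uncurry, norm_mul, Real.norm_of_nonneg (poissonWeight_pos _).le,
          Real.norm_of_nonneg (Real.exp_pos _).le]
        refine mul_le_mul_of_nonneg_left ?_ (poissonWeight_pos _).le
        refine mul_le_of_le_one_right (norm_nonneg _) (Real.exp_le_one_iff.2 ?_)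
        exact div_nonpos_of_nonpos_of_nonneg (by simp) (by positivity))
  rw [h1]
  have h2 : ∀ y : Eucl d, poissonWeight y * (τ ^ (-(d : ℝ) / 2) *
        ∫ z : Eucl d, f z * Real.exp (-‖x - ε • y - z‖ ^ 2 / (4 * τ)))
      = τ ^ (-(d : ℝ) / 2) * ∫ z : Eucl d,
        poissonWeight y * (f z * Real.exp (-‖x - ε • y - z‖ ^ 2 / (4 * τ))) := by
    intro y; rw [integral_const_mul]; ring
  simp_rw [h2]
  rw [integral_const_mul, hswap]
  congr 2; funext z
  rw [← integral_poissonWeight_mul_comp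
    (fun y => Real.exp (-‖x - y - z‖ ^ 2 / (4 * τ))) hε, ← integral_const_mul]
  congr 1; funext y; ring

/-- At ε = 0 the Poisson variable drops out of the argument of `f`, so its weight integrates to a
constant factor. -/
lemma smear_zero_eq {f : Eucl d → ℝ} (x : Eucl d) {τ : ℝ} (hτ : 0 < τ) :
    smear f x 0 τ = (∫ y : Eucl d, poissonWeight y) * (τ ^ (-(d : ℝ) / 2)
      * ∫ z : Eucl d, f z * Real.exp (-‖x - z‖ ^ 2 / (4 * τ))) := by
  rw [← integral_gaussWeight_mul_comp f x hτ, ← integral_prod_mul, ← Measure.volume_eq_prod, smear]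
  congr 1; funext p
  simp only [weight, zero_smul, sub_zero, mul_assoc]

end Scaling

/-- The kernel `τ^{-1/2}` times the Poisson-Gauss average of `f`. -/
def heatKer {d : ℕ} (f : Eucl d → ℝ) (x : Eucl d) (ε τ : ℝ) : ℝ :=
  τ ^ (-(1 / 2) : ℝ) * smear f x ε τ

/-- The time derivative of `heatKer`. -/
def heatKerDeriv {d : ℕ} (f : Eucl d → ℝ) (x : Eucl d) (ε τ : ℝ) : ℝ :=
  -(1 / 2) * τ ^ (-(3 / 2) : ℝ) * smear f x ε τ + heatKer (laplacian f) x ε τ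

/-- The time convolution of `φ` with `heatKer`. -/
def convPot {d : ℕ} (φ : ℝ → ℝ) (f : Eucl d → ℝ) (x : Eucl d) (ε t : ℝ) : ℝ :=
  ∫ s in (0 : ℝ)..t, φ s * heatKer f x ε (t - s)

/-- The constant relating `heatPotential` to `convPot`. -/
def potConst (d : ℕ) : ℝ := newtonConst d * (4 * Real.pi) ^ (-((d : ℝ) + 1) / 2)

lemma potConst_pos (d : ℕ) : 0 < potConst d :=
  mul_pos (newtonConst_pos d) (Real.rpow_pos_of_pos (by positivity) _)

section Potential

variable {d : ℕ} {a : ℝ} {ψ φ : ℝ → ℝ}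

lemma bdryData_last (y : Eucl d) (s : ℝ) :
    bdryData d a ψ φ y s (Fin.last d) = a * ψ ‖y‖ * φ s := by simp [bdryData]

lemma bdryData_castSucc (y : Eucl d) (s : ℝ) (i : Fin d) :
    bdryData d a ψ φ y s i.castSucc = 0 := by
  simp [bdryData, (Fin.castSucc_lt_last i).ne]

lemma heatPotential_castSucc (i : Fin d) (x : Eucl (d + 1)) (t : ℝ) :
    heatPotential (bdryData d a ψ φ) i.castSucc x t = 0 := by
  simp [heatPotential, bdryData_castSucc]

lemma gauss_bpt_zero (w : Eucl d) {τ : ℝ} (hτ : 0 < τ) :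
    gauss (bpt w 0) τ = (4 * Real.pi) ^ (-((d : ℝ) + 1) / 2) * τ ^ (-((d : ℝ) + 1) / 2)
      * Real.exp (-‖w‖ ^ 2 / (4 * τ)) := by
  rw [gauss, if_pos hτ, norm_sq_bpt, Real.mul_rpow (by positivity) hτ.le]
  push_cast
  simp

lemma heatPotential_last (hΨ : IsTest fun y : Eucl d => a * ψ ‖y‖) (x : Eucl d) {ε t : ℝ}
    (hε : 0 < ε) (ht : 0 < t) :
    heatPotential (bdryData d a ψ φ) (Fin.last d) (bpt x ε) t
      = potConst d * convPot φ (fun y => a * ψ ‖y‖) x ε t := by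
  rw [heatPotential, convPot, ← intervalIntegral.integral_const_mul]
  refine intervalIntegral.integral_congr_ae ?_
  filter_upwards [Measure.ae_ne volume t] with s hst hs
  rw [uIoc_of_le ht.le] at hs
  have hτ : 0 < t - s := sub_pos.2 (lt_of_le_of_ne hs.2 hst)
  set τ := t - s
  simp only [tang_bpt, normal_bpt, bdryData_last]
  have hy : ∀ z : Eucl d, ∫ y : Eucl d, pderiv (Fin.last d) newton (bpt y ε)
        * gauss (bpt (x - y - z) 0) τ
      = newtonConst d * ((4 * Real.pi) ^ (-((d : ℝ) + 1) / 2) * τ ^ (-((d : ℝ) + 1) / 2))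
        * ∫ y : Eucl d, ε * (‖y‖ ^ 2 + ε ^ 2) ^ (-((d : ℝ) + 1) / 2)
          * Real.exp (-‖x - y - z‖ ^ 2 / (4 * τ)) := by
    intro z
    rw [← integral_const_mul]
    congr 1; funext y
    rw [pderiv_last_newton _ _ (by positivity), gauss_bpt_zero _ hτ]
    ring
  simp_rw [hy]
  rw [heatKer, smear_eq hΨ x hε hτ, potConst]
  -- The Gaussian lives in dimension d + 1 but is integrated only over ℝᵈ; the surplus factor
  -- τ^(-1/2) is the weak singularity of `heatKer`.
  have hexp : τ ^ (-((d : ℝ) + 1) / 2) = τ ^ (-(1 / 2) : ℝ) * τ ^ (-(d : ℝ) / 2) := by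
    rw [← Real.rpow_add hτ]; congr 1; ring
  rw [hexp, ← integral_const_mul, ← integral_const_mul, ← integral_const_mul, ← integral_const_mul]
  congr 1; funext z; ring

variable {f : Eucl d → ℝ}

lemma hasDerivAt_heatKer (hf : IsTest f) (x : Eucl d) (ε : ℝ) {τ : ℝ} (hτ : 0 < τ) :
    HasDerivAt (heatKer f x ε) (heatKerDeriv f x ε τ) τ := by
  have h1 := (Real.hasDerivAt_rpow_const (x := τ) (p := (-(1 / 2) : ℝ)) (Or.inl hτ.ne')).mul
    (hasDerivAt_smear_time hf x ε hτ)
  refine h1.congr_deriv ?_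
  rw [heatKerDeriv, heatKer, show (-(1 / 2) - 1 : ℝ) = -(3 / 2) by norm_num]

lemma continuous_smear_time (hf : IsTest f) (x : Eucl d) (ε : ℝ) :
    Continuous (fun τ => smear f x ε τ) :=
  (continuous_smear hf).comp (g := fun u : Eucl d × ℝ × ℝ => smear f u.1 u.2.1 u.2.2)
    (f := fun τ => (x, ε, τ)) (by fun_prop)

lemma continuous_smear_scale (hf : IsTest f) (x : Eucl d) (τ : ℝ) :
    Continuous (fun ε => smear f x ε τ) :=
  (continuous_smear hf).comp (g := fun u : Eucl d × ℝ × ℝ => smear f u.1 u.2.1 u.2.2)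
    (f := fun ε => (x, ε, τ)) (by fun_prop)

lemma continuousOn_rpow_Ioi (r : ℝ) : ContinuousOn (fun τ : ℝ => τ ^ r) (Ioi 0) :=
  continuousOn_id.rpow_const fun _ hx => Or.inl (ne_of_gt hx)

lemma continuousOn_heatKer (hf : IsTest f) (x : Eucl d) (ε : ℝ) :
    ContinuousOn (heatKer f x ε) (Ioi 0) :=
  (continuousOn_rpow_Ioi _).mul (continuous_smear_time hf x ε).continuousOn

lemma continuousOn_heatKerDeriv (hf : IsTest f) (x : Eucl d) (ε : ℝ) :
    ContinuousOn (heatKerDeriv f x ε) (Ioi 0) :=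
  ((continuousOn_const.mul (continuousOn_rpow_Ioi _)).mul
    (continuous_smear_time hf x ε).continuousOn).add (continuousOn_heatKer hf.laplacian x ε)

lemma heatKer_bounded (hf : IsTest f) :
    ∃ C, 0 ≤ C ∧ ∀ x ε τ, 0 < τ → |heatKer f x ε τ| ≤ C * τ ^ (-(1 / 2) : ℝ) := by
  obtain ⟨C, hC0, hC⟩ := smear_bounded hf
  refine ⟨C, hC0, fun x ε τ hτ => ?_⟩
  have h := Real.rpow_nonneg hτ.le (-(1 / 2))
  rw [heatKer, abs_mul, abs_of_nonneg h, mul_comm]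
  exact mul_le_mul_of_nonneg_right (hC _ _ _) h

lemma intervalIntegrable_convPot (hφ : ContinuousOn φ (Ico 0 2)) (hf : IsTest f) (x : Eucl d)
    (ε : ℝ) {t : ℝ} (ht : t ∈ Ioo (0 : ℝ) 2) :
    IntervalIntegrable (fun s => φ s * heatKer f x ε (t - s)) volume 0 t := by
  obtain ⟨C, -, hC⟩ := heatKer_bounded hf
  exact intervalIntegrable_conv ht.1.le (hφ.mono fun u hu => ⟨hu.1, hu.2.trans_lt ht.2⟩)
    (continuousOn_heatKer hf x ε) (fun τ hτ => hC x ε τ hτ.1)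

lemma hasDerivAt_convPot_line (hφ : ContinuousOn φ (Ico 0 2)) (hf : IsTest f) (x : Eucl d)
    (ε : ℝ) {t : ℝ} (ht : t ∈ Ioo (0 : ℝ) 2) (i : Fin d) (h : ℝ) :
    HasDerivAt (fun h : ℝ => convPot φ f (x + h • EuclideanSpace.single i (1 : ℝ)) ε t)
      (convPot φ (pderiv i f) (x + h • EuclideanSpace.single i (1 : ℝ)) ε t) h := by
  obtain ⟨C, hC0, hC⟩ := heatKer_bounded (hf.pderiv i)
  obtain ⟨A, hA⟩ := isCompact_Icc.exists_bound_of_continuousOn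
    (hφ.mono (show Icc 0 t ⊆ Ico 0 2 from fun u hu => ⟨hu.1, hu.2.trans_lt ht.2⟩))
  have h1 : IntervalIntegrable (fun s => A * (C * (t - s) ^ (-(1 / 2) : ℝ))) volume 0 t := by
    have := (intervalIntegral.intervalIntegrable_rpow' (a := 0) (b := t)
      (r := -(1 / 2)) (by norm_num)).comp_sub_left t
    simp only [sub_zero, sub_self] at this
    exact (this.symm.const_mul C).const_mul A
  refine (intervalIntegral.hasDerivAt_integral_of_dominated_loc_of_deriv_le
    (μ := volume) (a := 0) (b := t) (x₀ := h) (s := univ)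
    (bound := fun s => A * (C * (t - s) ^ (-(1 / 2) : ℝ)))
    (F := fun h s => φ s * heatKer f (x + h • EuclideanSpace.single i (1 : ℝ)) ε (t - s))
    (F' := fun h s =>
      φ s * heatKer (pderiv i f) (x + h • EuclideanSpace.single i (1 : ℝ)) ε (t - s))
    univ_mem
    (Eventually.of_forall fun h =>
      (intervalIntegrable_convPot hφ hf _ ε ht).def'.aestronglyMeasurable)
    (intervalIntegrable_convPot hφ hf _ ε ht)
    (intervalIntegrable_convPot hφ (hf.pderiv i) _ ε ht).def'.aestronglyMeasurable
    ?_ h1 (Eventually.of_forall fun s _ h _ => ?_)).2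
  · filter_upwards [Measure.ae_ne volume t] with s hst hs h _
    rw [uIoc_of_le ht.1.le] at hs
    have ha := hA s ⟨hs.1.le, hs.2⟩
    rw [norm_mul]
    exact mul_le_mul ha (hC _ _ _ (sub_pos.2 (lt_of_le_of_ne hs.2 hst))) (norm_nonneg _)
      ((norm_nonneg _).trans ha)
  · exact ((hasDerivAt_smear_line hf i x ε (t - s) h).const_mul _).const_mul (φ s)

lemma convPot_laplacian (hφ : ContinuousOn φ (Ico 0 2)) (hf : IsTest f) (x : Eucl d)
    (ε : ℝ) {t : ℝ} (ht : t ∈ Ioo (0 : ℝ) 2) :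
    convPot φ (laplacian f) x ε t = ∑ i, convPot φ (pderiv i (pderiv i f)) x ε t := by
  simp only [convPot]
  rw [← intervalIntegral.integral_finsetSum fun i _ =>
    intervalIntegrable_convPot hφ ((hf.pderiv i).pderiv i) x ε ht]
  congr 1; funext s
  rw [← Finset.mul_sum]
  simp only [heatKer]
  rw [← Finset.mul_sum]
  congr 2
  simp only [smear, laplacian, Finset.mul_sum]
  exact integral_finsetSum _ fun i _ => integrable_smear ((hf.pderiv i).pderiv i) x ε (t - s)

/-- Translation invariance puts the tangential derivatives on the data rather than on the kernels,
so the time singularity remains τ^(-1/2), which is integrable. -/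
lemma tangLaplacian_heatPotential_last (hφ : ContinuousOn φ (Ico 0 2))
    (hΨ : IsTest fun y : Eucl d => a * ψ ‖y‖) (x : Eucl d) {ε t : ℝ}
    (hε : 0 < ε) (ht : t ∈ Ioo (0 : ℝ) 2) :
    tangLaplacian (fun ξ => heatPotential (bdryData d a ψ φ) (Fin.last d) ξ t) (bpt x ε)
      = potConst d * convPot φ (laplacian fun y => a * ψ ‖y‖) x ε t := by
  rw [convPot_laplacian hφ hΨ x ε ht, Finset.mul_sum, tangLaplacian]
  refine Finset.sum_congr rfl fun i _ => ?_
  have h1 : ∀ y : Eucl d, pderiv i.castSucc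
      (fun ξ => heatPotential (bdryData d a ψ φ) (Fin.last d) ξ t) (bpt y ε)
      = potConst d * convPot φ (pderiv i fun y => a * ψ ‖y‖) y ε t := by
    intro y
    rw [pderiv, lineDeriv]
    simp only [bpt_add_smul_castSucc, heatPotential_last hΨ _ hε ht.1]
    simpa using ((hasDerivAt_convPot_line hφ hΨ y ε ht i 0).const_mul (potConst d)).deriv
  rw [pderiv, lineDeriv]
  simp only [bpt_add_smul_castSucc, h1]
  simpa using ((hasDerivAt_convPot_line hφ (hΨ.pderiv i) x ε ht i 0).const_mul (potConst d)).deriv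

lemma tendsto_convPot (hφ : ContinuousOn φ (Ico 0 2)) (hf : IsTest f) (x : Eucl d)
    {t : ℝ} (ht : t ∈ Ioo (0 : ℝ) 2) :
    Tendsto (fun ε => convPot φ f x ε t) (𝓝[>] 0) (𝓝 (convPot φ f x 0 t)) := by
  obtain ⟨C, hC0, hC⟩ := heatKer_bounded hf
  obtain ⟨A, hA⟩ := isCompact_Icc.exists_bound_of_continuousOn
    (hφ.mono (show Icc 0 t ⊆ Ico 0 2 from fun u hu => ⟨hu.1, hu.2.trans_lt ht.2⟩))
  have h1 : IntervalIntegrable (fun s => A * (C * (t - s) ^ (-(1 / 2) : ℝ))) volume 0 t := by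
    have := (intervalIntegral.intervalIntegrable_rpow' (a := 0) (b := t)
      (r := -(1 / 2)) (by norm_num)).comp_sub_left t
    simp only [sub_zero, sub_self] at this
    exact (this.symm.const_mul C).const_mul A
  refine intervalIntegral.tendsto_integral_filter_of_dominated_convergence _
    (Eventually.of_forall fun ε =>
      (intervalIntegrable_convPot hφ hf x ε ht).def'.aestronglyMeasurable)
    (Eventually.of_forall fun ε => ?_) h1 (Eventually.of_forall fun s _ => ?_)
  · filter_upwards [Measure.ae_ne volume t] with s hst hs
    rw [uIoc_of_le ht.1.le] at hs
    have ha := hA s ⟨hs.1.le, hs.2⟩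
    rw [norm_mul]
    exact mul_le_mul ha (hC _ _ _ (sub_pos.2 (lt_of_le_of_ne hs.2 hst))) (norm_nonneg _)
      ((norm_nonneg _).trans ha)
  · exact ((((continuous_smear_scale hf x (t - s)).tendsto 0).mono_left
      nhdsWithin_le_nhds).const_mul _).const_mul _

end Potential

/-! ### The boundary limit of the heat potential away from the support of the data -/

/-- At the only delicate point, τ = 0, the difference quotient is at most |C| √|h|. -/
lemma hasDerivAt_indicator_of_flat {k k' : ℝ → ℝ} {C : ℝ}
    (hk : ∀ τ, 0 < τ → HasDerivAt k (k' τ) τ)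
    (hC : ∀ τ, 0 < τ → |k τ| ≤ C * (τ * √τ)) (τ : ℝ) :
    HasDerivAt ((Ioi 0).indicator k) ((Ioi 0).indicator k' τ) τ := by
  rcases lt_trichotomy τ 0 with h | rfl | h
  · rw [indicator_of_notMem (by simpa using h.le)]
    refine (hasDerivAt_const τ (0 : ℝ)).congr_of_eventuallyEq ?_
    filter_upwards [Iio_mem_nhds h] with σ hσ
    exact indicator_of_notMem (by simpa using le_of_lt hσ) _
  · rw [indicator_of_notMem (by simp), hasDerivAt_iff_tendsto_slope_zero]
    have hlim : Tendsto (fun h : ℝ => |C| * √|h|) (𝓝[≠] 0) (𝓝 0) := by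
      have : Continuous (fun h : ℝ => |C| * √|h|) := by fun_prop
      simpa using (this.tendsto 0).mono_left nhdsWithin_le_nhds
    refine squeeze_zero_norm (fun h => ?_) hlim
    rw [indicator_of_notMem (s := Ioi (0 : ℝ)) (a := 0) (by simp), sub_zero, zero_add, smul_eq_mul,
      norm_mul, norm_inv]
    rcases lt_or_ge 0 h with hh | hh
    · rw [indicator_of_mem (show h ∈ Ioi 0 from hh), Real.norm_of_nonneg hh.le, abs_of_pos hh,
        inv_mul_le_iff₀ hh]
      refine (hC h hh).trans ?_
      have := mul_le_mul_of_nonneg_right (le_abs_self C) (show 0 ≤ h * √h by positivity)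
      linarith
    · rw [indicator_of_notMem (by simpa using hh), norm_zero, mul_zero]; positivity
  · rw [indicator_of_mem (show τ ∈ Ioi 0 from h)]
    refine (hk τ h).congr_of_eventuallyEq ?_
    filter_upwards [Ioi_mem_nhds h] with σ hσ
    exact indicator_of_mem hσ _

lemma continuous_indicator_of_flat {k' : ℝ → ℝ} {C : ℝ} (hk' : ContinuousOn k' (Ioi 0))
    (hC : ∀ τ, 0 < τ → |k' τ| ≤ C * ((1 + τ) * √τ)) :
    Continuous ((Ioi 0).indicator k') := by
  refine continuous_iff_continuousAt.2 fun τ => ?_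
  rcases lt_trichotomy τ 0 with h | rfl | h
  · refine (continuousAt_const (y := (0 : ℝ))).congr ?_
    filter_upwards [Iio_mem_nhds h] with σ hσ
    exact (indicator_of_notMem (by simpa using le_of_lt hσ) _).symm
  · have hlim : Tendsto (fun h : ℝ => |C| * ((1 + |h|) * √|h|)) (𝓝 0) (𝓝 0) := by
      have : Continuous (fun h : ℝ => |C| * ((1 + |h|) * √|h|)) := by fun_prop
      simpa using this.tendsto 0
    rw [ContinuousAt, indicator_of_notMem (by simp)]
    refine squeeze_zero_norm (fun h => ?_) hlim
    rcases lt_or_ge 0 h with hh | hh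
    · rw [indicator_of_mem (show h ∈ Ioi 0 from hh), abs_of_pos hh]
      exact (hC h hh).trans (mul_le_mul_of_nonneg_right (le_abs_self C) (by positivity))
    · rw [indicator_of_notMem (by simpa using hh), norm_zero]; positivity
  · refine (hk'.continuousAt (Ioi_mem_nhds h)).congr ?_
    filter_upwards [Ioi_mem_nhds h] with σ hσ
    exact (indicator_of_mem hσ _).symm

section Boundary

variable {d : ℕ} {f : Eucl d → ℝ} {φ φ' : ℝ → ℝ}

lemma rpow_neg_half_mul_sq {τ : ℝ} (hτ : 0 < τ) : τ ^ (-(1 / 2) : ℝ) * τ ^ 2 = τ * √τ := by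
  rw [Real.sqrt_eq_rpow, ← Real.rpow_natCast τ 2, ← Real.rpow_add hτ]
  nth_rewrite 2 [← Real.rpow_one τ]
  rw [← Real.rpow_add hτ]; norm_num

lemma rpow_neg_three_half_mul_sq {τ : ℝ} (hτ : 0 < τ) : τ ^ (-(3 / 2) : ℝ) * τ ^ 2 = √τ := by
  rw [Real.sqrt_eq_rpow, ← Real.rpow_natCast τ 2, ← Real.rpow_add hτ]; norm_num

lemma abs_heatKer_zero_le (hf : IsTest f) {x : Eucl d} (hx : 2 < ‖x‖) :
    ∃ C, 0 ≤ C ∧ ∀ τ, 0 < τ → |heatKer f x 0 τ| ≤ C * (τ * √τ) := by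
  obtain ⟨C, hC0, hC⟩ := abs_smear_zero_le hf hx
  refine ⟨C, hC0, fun τ hτ => ?_⟩
  have h := Real.rpow_nonneg hτ.le (-(1 / 2))
  rw [heatKer, abs_mul, abs_of_nonneg h, ← rpow_neg_half_mul_sq hτ]
  calc _ ≤ τ ^ (-(1 / 2) : ℝ) * (C * τ ^ 2) := mul_le_mul_of_nonneg_left (hC τ hτ.le) h
    _ = _ := by ring

lemma abs_heatKerDeriv_zero_le (hf : IsTest f) {x : Eucl d} (hx : 2 < ‖x‖) :
    ∃ C, 0 ≤ C ∧ ∀ τ, 0 < τ → |heatKerDeriv f x 0 τ| ≤ C * ((1 + τ) * √τ) := by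
  obtain ⟨C, hC0, hC⟩ := abs_smear_zero_le hf hx
  obtain ⟨B, hB0, hB⟩ := abs_heatKer_zero_le hf.laplacian hx
  refine ⟨C + B, by positivity, fun τ hτ => ?_⟩
  have h := Real.rpow_nonneg hτ.le (-(3 / 2))
  have h1 : |-(1 / 2) * τ ^ (-(3 / 2) : ℝ) * smear f x 0 τ| ≤ C * √τ := by
    rw [abs_mul, abs_mul, abs_of_nonneg h, ← rpow_neg_three_half_mul_sq hτ]
    have h2 := mul_le_mul_of_nonneg_left (hC τ hτ.le) h
    have h3 : 0 ≤ τ ^ (-(3 / 2) : ℝ) * |smear f x 0 τ| := by positivity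
    norm_num
    nlinarith
  refine (abs_add_le _ _).trans ((add_le_add h1 (hB τ hτ)).trans ?_)
  have h4 : 0 ≤ √τ := Real.sqrt_nonneg _
  nlinarith [mul_nonneg hC0 (mul_nonneg hτ.le h4), mul_nonneg hB0 h4]

/-- The Laplacian term in `heatKerDeriv` cancels the subtracted potential, leaving the derivative of
τ^(-1/2). Flatness at ε = 0 makes the extension of the limit kernel by zero C¹, as
`tendsto_deriv_conv` requires. -/
lemma tendsto_deriv_convPot_sub_laplacian {t δ : ℝ} (hδ : 0 < δ) (hδt : 2 * δ < t)
    (hδ2 : t + 2 * δ < 2) (hφ : ContinuousOn φ (Ico 0 2))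
    (hφd : ∀ u ∈ Icc (t - 2 * δ) (t + 2 * δ), HasDerivAt φ (φ' u) u)
    (hφ' : ContinuousOn φ' (Icc (t - 2 * δ) (t + 2 * δ))) (hf : IsTest f) {x : Eucl d}
    (hx : 2 < ‖x‖) :
    Tendsto (fun ε => deriv (fun r => convPot φ f x ε r) t - convPot φ (laplacian f) x ε t)
      (𝓝[>] 0)
      (𝓝 (-(1 / 2) * ∫ s in (0 : ℝ)..t, φ s * ((t - s) ^ (-(3 / 2) : ℝ) * smear f x 0 (t - s)))) := by
  have ht : t ∈ Ioo (0 : ℝ) 2 := ⟨by linarith, by linarith⟩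
  obtain ⟨C, hC0, hC⟩ := heatKer_bounded hf
  obtain ⟨B, hB0, hB⟩ := heatKer_bounded hf.laplacian
  obtain ⟨S, hS0, hS⟩ := smear_bounded hf
  obtain ⟨K, -, hK⟩ := abs_heatKer_zero_le hf hx
  obtain ⟨K', -, hK'⟩ := abs_heatKerDeriv_zero_le hf hx
  have hκ'c := continuous_indicator_of_flat (continuousOn_heatKerDeriv hf x 0) hK'
  have hlimk : ∀ (g : Eucl d → ℝ), IsTest g → ∀ τ,
      Tendsto (fun ε => smear g x ε τ) (𝓝[>] 0) (𝓝 (smear g x 0 τ)) := fun g hg τ =>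
    ((continuous_smear_scale hg x τ).tendsto 0).mono_left nhdsWithin_le_nhds
  have h1 := tendsto_deriv_conv (k := heatKer f x) (k' := heatKerDeriv f x)
    (κ := (Ioi 0).indicator (heatKer f x 0)) (κ' := (Ioi 0).indicator (heatKerDeriv f x 0))
    -- C' bounds the two terms of `heatKerDeriv` for τ ≥ δ/2, where both negative powers of τ are
    -- largest at δ/2.
    (C := C) (C' := 1 / 2 * (δ / 2) ^ (-(3 / 2) : ℝ) * S + B * (δ / 2) ^ (-(1 / 2) : ℝ))
    hδ hδt hδ2 hφ hφd hφ'
    (fun ε τ hτ => hasDerivAt_heatKer hf x ε hτ) (continuousOn_heatKerDeriv hf x)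
    (fun ε τ hτ => hC x ε τ hτ.1)
    (fun ε τ hτ => by
      have hτ0 : 0 < τ := lt_of_lt_of_le (by linarith) hτ.1
      refine (abs_add_le _ _).trans (add_le_add ?_ ((hB x ε τ hτ0).trans ?_))
      · rw [abs_mul, abs_mul, abs_of_nonneg (Real.rpow_nonneg hτ0.le _)]
        have h2 : τ ^ (-(3 / 2) : ℝ) ≤ (δ / 2) ^ (-(3 / 2) : ℝ) :=
          Real.rpow_le_rpow_of_nonpos (by linarith) hτ.1 (by norm_num)
        have h3 : |(-(1 / 2) : ℝ)| = 1 / 2 := by norm_num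
        rw [h3]
        gcongr
        exact hS _ _ _
      · exact mul_le_mul_of_nonneg_left
          (Real.rpow_le_rpow_of_nonpos (by linarith) hτ.1 (by norm_num)) hB0)
    (fun τ _ => (hlimk f hf τ).const_mul _)
    (fun τ _ => ((hlimk f hf τ).const_mul _).add ((hlimk _ hf.laplacian τ).const_mul _))
    (hasDerivAt_indicator_of_flat (fun τ hτ => hasDerivAt_heatKer hf x 0 hτ) hK) hκ'c
    (fun τ hτ => indicator_of_notMem (by simpa using hτ) _)
    (fun τ hτ => indicator_of_mem (show τ ∈ Ioi 0 from hτ) _)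
  have h2 := h1.sub (tendsto_convPot hφ hf.laplacian x ht)
  have hval : (∫ s in (0 : ℝ)..t, φ s * (Ioi 0).indicator (heatKerDeriv f x 0) (t - s))
      - convPot φ (laplacian f) x 0 t
      = -(1 / 2) * ∫ s in (0 : ℝ)..t, φ s * ((t - s) ^ (-(3 / 2) : ℝ) * smear f x 0 (t - s)) := by
    rw [convPot, ← intervalIntegral.integral_sub, ← intervalIntegral.integral_const_mul]
    · refine intervalIntegral.integral_congr_ae ?_
      filter_upwards [Measure.ae_ne volume t] with s hst hs
      rw [uIoc_of_le ht.1.le] at hs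
      rw [indicator_of_mem (show t - s ∈ Ioi 0 from sub_pos.2 (lt_of_le_of_ne hs.2 hst)),
        heatKerDeriv]
      ring
    · refine ContinuousOn.intervalIntegrable (ContinuousOn.mul ?_
        (hκ'c.comp (by fun_prop)).continuousOn)
      rw [uIcc_of_le ht.1.le]
      exact hφ.mono fun u hu => ⟨hu.1, hu.2.trans_lt ht.2⟩
    · exact intervalIntegrable_convPot hφ hf.laplacian x 0 ht
  rw [hval] at h2
  exact h2

/-- With u = ρ/(4τ), raising u/m ≤ exp(u/m) to the power m gives (u/m)^m ≤ exp u. The bound is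
uniform in τ and decays in ρ, which serves both domination and the far-field estimate. -/
lemma rpow_neg_mul_exp_neg_le {m ρ τ : ℝ} (hm : 0 < m) (hρ : 0 < ρ) (hτ : 0 < τ) :
    τ ^ (-m) * Real.exp (-ρ / (4 * τ)) ≤ (4 * m) ^ m * ρ ^ (-m) := by
  set u := ρ / (4 * τ) with hu
  have hu0 : 0 < u := by positivity
  have h1 : (u / m) ^ m ≤ Real.exp u := by
    have h2 : u / m ≤ Real.exp (u / m) := by linarith [Real.add_one_le_exp (u / m)]
    calc (u / m) ^ m ≤ (Real.exp (u / m)) ^ m := Real.rpow_le_rpow (by positivity) h2 hm.le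
      _ = Real.exp u := by rw [← Real.exp_mul]; congr 1; field_simp
  have h3 : u / m = ρ / (τ * (4 * m)) := by rw [hu]; field_simp
  rw [h3, Real.div_rpow hρ.le (by positivity), Real.mul_rpow hτ.le (by positivity)] at h1
  rw [neg_div, ← hu, Real.exp_neg, Real.rpow_neg hτ.le, Real.rpow_neg hρ.le]
  have h4 : 0 < τ ^ m := Real.rpow_pos_of_pos hτ _
  have h5 : 0 < ρ ^ m := Real.rpow_pos_of_pos hρ _
  have h6 : 0 < (4 * m) ^ m := Real.rpow_pos_of_pos (by positivity) _
  have h7 := Real.exp_pos u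
  rw [div_le_iff₀ (by positivity)] at h1
  rw [← mul_inv, ← div_eq_mul_inv, le_div_iff₀ h5, inv_mul_le_iff₀ (by positivity)]
  linarith

/-- The time convolution of `φ` with `τ⁻ᵐ exp(-ρ / 4τ)`; for `m = (d + 3) / 2` it is the radial
profile of the heat contribution to the boundary pressure, `ρ` being the squared distance. -/
def heatRadial (m : ℝ) (φ : ℝ → ℝ) (t ρ : ℝ) : ℝ :=
  ∫ s in (0 : ℝ)..t, φ s * ((t - s) ^ (-m) * Real.exp (-ρ / (4 * (t - s))))

/-- Fubini in time and space. The exponent collects 3/2 from the differentiated kernel and d/2 from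
the Gaussian. Integrability up to s = t holds because ‖x - z‖ ≥ 1 wherever `f z` is nonzero. -/
lemma integral_smear_zero_eq (hφ : ContinuousOn φ (Ico 0 2)) (hf : IsTest f) {x : Eucl d}
    (hx : 2 < ‖x‖) {t : ℝ} (ht : t ∈ Ioo (0 : ℝ) 2) :
    ∫ s in (0 : ℝ)..t, φ s * ((t - s) ^ (-(3 / 2) : ℝ) * smear f x 0 (t - s))
      = (∫ y : Eucl d, poissonWeight y)
        * ∫ z : Eucl d, f z * heatRadial (((d : ℝ) + 3) / 2) φ t (‖x - z‖ ^ 2) := by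
  have hfc := hf.continuous
  set m : ℝ := ((d : ℝ) + 3) / 2 with hm
  have hm0 : 0 < m := by positivity
  obtain ⟨A, hA⟩ := isCompact_Icc.exists_bound_of_continuousOn
    (hφ.mono (show Icc 0 t ⊆ Ico 0 2 from fun u hu => ⟨hu.1, hu.2.trans_lt ht.2⟩))
  have hA0 : 0 ≤ A := (norm_nonneg _).trans (hA 0 ⟨le_rfl, ht.1.le⟩)
  have hint : Integrable (Function.uncurry fun (s : ℝ) (z : Eucl d) =>
      φ s * ((t - s) ^ (-m) * (f z * Real.exp (-‖x - z‖ ^ 2 / (4 * (t - s))))))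
      ((volume.restrict (Ioo 0 t)).prod volume) := by
    have hφm : AEStronglyMeasurable φ (volume.restrict (Ioo 0 t)) :=
      (hφ.mono fun u hu => ⟨hu.1.le, hu.2.trans ht.2⟩).aestronglyMeasurable measurableSet_Ioo
    refine Integrable.mono' ((integrable_const (μ := volume.restrict (Ioo 0 t))
      (A * (4 * m) ^ m)).mul_prod hf.integrable.norm) ?_ ?_
    · refine (hφm.comp_fst (ν := (volume : Measure (Eucl d)))).mul
        (Measurable.aestronglyMeasurable ?_)
      have := hfc.measurable
      fun_prop
    · have hmem : ∀ᵐ p : ℝ × Eucl d ∂((volume.restrict (Ioo 0 t)).prod volume), p.1 ∈ Ioo 0 t :=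
        Measure.quasiMeasurePreserving_fst.ae (ae_restrict_mem measurableSet_Ioo)
      filter_upwards [hmem] with p hp
      simp only [Function.uncurry]
      have hτ : 0 < t - p.1 := sub_pos.2 hp.2
      rw [norm_mul, norm_mul, norm_mul, Real.norm_of_nonneg (Real.exp_pos _).le,
        Real.norm_of_nonneg (Real.rpow_nonneg hτ.le _), mul_assoc A]
      refine mul_le_mul (hA _ ⟨hp.1.le, hp.2.le⟩) ?_ (by positivity) hA0
      rcases le_or_gt 1 ‖p.2‖ with h | h
      · rw [hf.eq_zero h]; simp
      · have h1 : 1 ≤ ‖x - p.2‖ ^ 2 := by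
          have := norm_sub_norm_le x p.2
          have h2 : 1 ≤ ‖x - p.2‖ := by linarith
          exact one_le_pow₀ h2
        have h3 := rpow_neg_mul_exp_neg_le hm0 (lt_of_lt_of_le one_pos h1) hτ
        have h4 : (‖x - p.2‖ ^ 2) ^ (-m) ≤ 1 := Real.rpow_le_one_of_one_le_of_nonpos h1 (by linarith)
        have h5 : 0 ≤ (4 * m) ^ m := by positivity
        have h6 := mul_le_mul_of_nonneg_right (h3.trans (mul_le_of_le_one_right h5 h4))
          (norm_nonneg (f p.2))
        linarith
  have hswap := integral_integral_swap hint
  have e1 : ∫ s in (0 : ℝ)..t, φ s * ((t - s) ^ (-(3 / 2) : ℝ) * smear f x 0 (t - s))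
      = (∫ y : Eucl d, poissonWeight y) * ∫ s in Ioo 0 t, ∫ z : Eucl d,
        φ s * ((t - s) ^ (-m) * (f z * Real.exp (-‖x - z‖ ^ 2 / (4 * (t - s))))) := by
    rw [intervalIntegral.integral_of_le ht.1.le, integral_Ioc_eq_integral_Ioo,
      ← integral_const_mul]
    refine setIntegral_congr_fun measurableSet_Ioo fun s hs => ?_
    have hτ : 0 < t - s := sub_pos.2 hs.2
    rw [smear_zero_eq x hτ, integral_const_mul, integral_const_mul,
      show -m = -(3 / 2) + -(d : ℝ) / 2 by rw [hm]; ring, Real.rpow_add hτ]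
    ring
  rw [e1, hswap]
  congr 2; funext z
  rw [heatRadial, intervalIntegral.integral_of_le ht.1.le, integral_Ioc_eq_integral_Ioo,
    ← integral_const_mul]
  congr 1; funext s
  ring

end Boundary

/-! ### The radial heat profile -/

section HeatRadial

variable {φ : ℝ → ℝ} {m t : ℝ}

lemma intervalIntegrable_heatRadial (hm : 0 < m) (hφ : ContinuousOn φ (Ico 0 2))
    (ht : t ∈ Ioo (0 : ℝ) 2) {ρ : ℝ} (hρ : 0 < ρ) :
    IntervalIntegrable (fun s => φ s * ((t - s) ^ (-m) * Real.exp (-ρ / (4 * (t - s)))))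
      volume 0 t := by
  have hφI : ContinuousOn φ (Icc 0 t) := hφ.mono fun u hu => ⟨hu.1, hu.2.trans_lt ht.2⟩
  have h1 : IntervalIntegrable (fun s => (t - s) ^ (-m) * Real.exp (-ρ / (4 * (t - s))))
      volume 0 t := by
    refine (intervalIntegrable_const (c := (4 * m) ^ m * ρ ^ (-m))).mono_fun
      (Measurable.aestronglyMeasurable (by fun_prop)) ?_
    rw [uIoc_of_le ht.1.le]
    filter_upwards [ae_restrict_mem measurableSet_Ioc,
      (Measure.ae_ne volume t).filter_mono (ae_mono Measure.restrict_le_self)] with s hs hst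
    have hτ : 0 < t - s := sub_pos.2 (lt_of_le_of_ne hs.2 hst)
    rw [Real.norm_of_nonneg (by positivity), Real.norm_of_nonneg (by positivity)]
    exact rpow_neg_mul_exp_neg_le hm hρ hτ
  exact h1.continuousOn_mul (by rwa [uIcc_of_le ht.1.le])

/-- Each derivative in ρ brings down -1/(4τ), raising m by one; the exponential still absorbs the
larger power while ρ stays away from 0. -/
lemma hasDerivAt_heatRadial (hm : 0 < m) (hφ : ContinuousOn φ (Ico 0 2))
    (ht : t ∈ Ioo (0 : ℝ) 2) {ρ : ℝ} (hρ : 0 < ρ) :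
    HasDerivAt (heatRadial m φ t) (-(1 / 4) * heatRadial (m + 1) φ t ρ) ρ := by
  have hm1 : 0 < m + 1 := by linarith
  obtain ⟨A, hA⟩ := isCompact_Icc.exists_bound_of_continuousOn
    (hφ.mono (show Icc 0 t ⊆ Ico 0 2 from fun u hu => ⟨hu.1, hu.2.trans_lt ht.2⟩))
  have h := (intervalIntegral.hasDerivAt_integral_of_dominated_loc_of_deriv_le
    (μ := volume) (a := 0) (b := t) (x₀ := ρ) (s := Ioi (ρ / 2))
    (bound := fun _ => 1 / 4 * (A * ((4 * (m + 1)) ^ (m + 1) * (ρ / 2) ^ (-(m + 1)))))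
    (F := fun ρ s => φ s * ((t - s) ^ (-m) * Real.exp (-ρ / (4 * (t - s)))))
    (F' := fun ρ s => -(1 / 4) * (φ s * ((t - s) ^ (-(m + 1)) * Real.exp (-ρ / (4 * (t - s))))))
    (Ioi_mem_nhds (by linarith))
    (by
      filter_upwards [Ioi_mem_nhds hρ] with σ hσ
      exact (intervalIntegrable_heatRadial hm hφ ht hσ).def'.aestronglyMeasurable)
    (intervalIntegrable_heatRadial hm hφ ht hρ)
    ((intervalIntegrable_heatRadial hm1 hφ ht hρ).const_mul _).def'.aestronglyMeasurable
    ?_ intervalIntegrable_const ?_).2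
  · refine h.congr_deriv ?_
    rw [intervalIntegral.integral_const_mul, heatRadial]
  · filter_upwards [Measure.ae_ne volume t] with s hst hs σ hσ
    rw [uIoc_of_le ht.1.le] at hs
    have hτ : 0 < t - s := sub_pos.2 (lt_of_le_of_ne hs.2 hst)
    have hσ' : ρ / 2 < σ := hσ
    have hσ0 : 0 < σ := by linarith
    have ha := hA s ⟨hs.1.le, hs.2⟩
    rw [norm_mul, norm_mul, Real.norm_of_nonneg (r := (_ : ℝ) * Real.exp _) (by positivity)]
    have h1 : ‖(-(1 / 4) : ℝ)‖ = 1 / 4 := by norm_num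
    rw [h1]
    refine mul_le_mul_of_nonneg_left (mul_le_mul ha ?_ (by positivity)
      ((norm_nonneg _).trans ha)) (by norm_num)
    refine (rpow_neg_mul_exp_neg_le hm1 hσ0 hτ).trans (mul_le_mul_of_nonneg_left ?_ (by positivity))
    exact Real.rpow_le_rpow_of_nonpos (by linarith) hσ'.le (by linarith)
  · filter_upwards [Measure.ae_ne volume t] with s hst hs σ hσ
    rw [uIoc_of_le ht.1.le] at hs
    have hτ : 0 < t - s := sub_pos.2 (lt_of_le_of_ne hs.2 hst)
    have h1 : HasDerivAt (fun σ : ℝ => -σ / (4 * (t - s))) (-1 / (4 * (t - s))) σ :=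
      (hasDerivAt_id σ).neg.div_const _
    refine ((h1.exp.const_mul ((t - s) ^ (-m))).const_mul (φ s)).congr_deriv ?_
    rw [show -(m + 1) = -m - 1 by ring, Real.rpow_sub_one hτ.ne']
    field_simp

lemma continuousOn_heatRadial (hm : 0 < m) (hφ : ContinuousOn φ (Ico 0 2))
    (ht : t ∈ Ioo (0 : ℝ) 2) : ContinuousOn (heatRadial m φ t) (Ioi 0) :=
  fun _ hρ => (hasDerivAt_heatRadial hm hφ ht hρ).continuousAt.continuousWithinAt

lemma heatRadial_nonneg (ht : 0 < t) (hφ : ∀ s ∈ Ioo 0 t, 0 ≤ φ s) (ρ : ℝ) :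
    0 ≤ heatRadial m φ t ρ := by
  rw [heatRadial, intervalIntegral.integral_of_le ht.le, integral_Ioc_eq_integral_Ioo]
  refine setIntegral_nonneg measurableSet_Ioo fun s hs => ?_
  have : 0 < t - s := sub_pos.2 hs.2
  exact mul_nonneg (hφ s hs) (by positivity)

/-- Strict positivity is contributed by the times s in (0, 1), since φ may vanish after time 1. -/
lemma heatRadial_pos (hm : 0 < m) (hφ : ContinuousOn φ (Ico 0 2)) (ht : t ∈ Ioo (1 : ℝ) 2)
    (hφ0 : ∀ s ∈ Ioo (0 : ℝ) 1, 0 < φ s) (hφ1 : ∀ s ∈ Ioo (1 : ℝ) 2, 0 ≤ φ s) {ρ : ℝ}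
    (hρ : 0 < ρ) : 0 < heatRadial m φ t ρ := by
  have ht0 : 0 < t := by linarith [ht.1]
  have h1 := intervalIntegrable_heatRadial hm hφ ⟨ht0, ht.2⟩ hρ
  have hsub : uIcc (0 : ℝ) 1 ⊆ uIcc 0 t := by
    rw [uIcc_of_le zero_le_one, uIcc_of_le ht0.le]; exact Icc_subset_Icc_right ht.1.le
  rw [heatRadial, ← intervalIntegral.integral_add_adjacent_intervals (b := 1)
    (h1.mono_set hsub) (h1.mono_set (by
      rw [uIcc_of_le ht.1.le, uIcc_of_le ht0.le]; exact Icc_subset_Icc_left zero_le_one))]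
  refine add_pos_of_pos_of_nonneg ?_ ?_
  · refine intervalIntegral.intervalIntegral_pos_of_pos_on (h1.mono_set hsub)
      (fun s hs => ?_) zero_lt_one
    have : 0 < t - s := by linarith [hs.2, ht.1]
    exact mul_pos (hφ0 s hs) (by positivity)
  · rw [intervalIntegral.integral_of_le ht.1.le, integral_Ioc_eq_integral_Ioo]
    refine setIntegral_nonneg measurableSet_Ioo fun s hs => ?_
    have : 0 < t - s := sub_pos.2 hs.2
    exact mul_nonneg (hφ1 s ⟨hs.1, hs.2.trans ht.2⟩) (by positivity)

lemma heatRadial_le (hm : 0 < m) (ht : 0 < t) (ht1 : t ≤ 1) {A : ℝ}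
    (hφ : ∀ s ∈ Ioo 0 t, |φ s| ≤ A) (hA : 0 ≤ A) {ρ : ℝ} (hρ : 0 < ρ) :
    heatRadial m φ t ρ ≤ A * ((4 * m) ^ m * ρ ^ (-m)) := by
  have h0 : 0 ≤ A * ((4 * m) ^ m * ρ ^ (-m)) := by positivity
  have h1 : ‖heatRadial m φ t ρ‖ ≤ A * ((4 * m) ^ m * ρ ^ (-m)) * |t - 0| := by
    refine intervalIntegral.norm_integral_le_of_norm_le_const_ae ?_
    filter_upwards [Measure.ae_ne volume t] with s hst hs
    rw [uIoc_of_le ht.le] at hs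
    have hτ : 0 < t - s := sub_pos.2 (lt_of_le_of_ne hs.2 hst)
    rw [norm_mul, Real.norm_of_nonneg (r := (_ : ℝ) * Real.exp _) (by positivity)]
    exact mul_le_mul (hφ s ⟨hs.1, lt_of_le_of_ne hs.2 hst⟩) (rpow_neg_mul_exp_neg_le hm hρ hτ)
      (by positivity) hA
  refine (le_abs_self _).trans (h1.trans ?_)
  rw [sub_zero, abs_of_pos ht]
  exact mul_le_of_le_one_right h0 ht1

end HeatRadial

/-! ### Radial potentials of radial densities -/

section RadialPotential

variable {d : ℕ} {f : Eucl d → ℝ} {K K' : ℝ → ℝ}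

lemma norm_sub_sq_mem {x z : Eucl d} (hx : 2 < ‖x‖) (hz : z ∈ Metric.closedBall (0 : Eucl d) 1) :
    ‖x - z‖ ^ 2 ∈ Icc 1 ((‖x‖ + 1) ^ 2) := by
  rw [mem_closedBall_zero_iff] at hz
  have h1 := norm_sub_norm_le x z
  have h2 := norm_sub_le x z
  exact ⟨one_le_pow₀ (by linarith), pow_le_pow_left₀ (norm_nonneg _) (by linarith) 2⟩

lemma IsTest.integral_mul_eq (hf : IsTest f) (h : Eucl d → ℝ) :
    ∫ z, f z * h z = ∫ z in Metric.closedBall (0 : Eucl d) 1, f z * h z := by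
  refine (setIntegral_eq_integral_of_forall_compl_eq_zero fun z hz => ?_).symm
  rw [mem_closedBall_zero_iff, not_le] at hz
  rw [hf.eq_zero hz.le, zero_mul]

lemma continuousOn_mul_radial (hf : IsTest f) (hK : ContinuousOn K (Ioi 0)) {x : Eucl d}
    (hx : 2 < ‖x‖) {c : ℝ} (hc : 0 ≤ c) :
    ContinuousOn (fun z => f z * K (‖x - z‖ ^ 2 + c)) (Metric.closedBall 0 1) := by
  refine hf.continuous.continuousOn.mul (hK.comp (by fun_prop) fun z hz => ?_)
  have h1 := (norm_sub_sq_mem hx hz).1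
  have h2 : 0 < ‖x - z‖ ^ 2 + c := by linarith
  exact h2

lemma integrable_mul_radial (hf : IsTest f) (hK : ContinuousOn K (Ioi 0)) {x : Eucl d}
    (hx : 2 < ‖x‖) {c : ℝ} (hc : 0 ≤ c) : Integrable (fun z => f z * K (‖x - z‖ ^ 2 + c)) := by
  rw [← integrableOn_iff_integrable_of_support_subset (s := Metric.closedBall (0 : Eucl d) 1)]
  · exact (continuousOn_mul_radial hf hK hx hc).integrableOn_compact (isCompact_closedBall _ _)
  · intro z hz
    by_contra h
    rw [mem_closedBall_zero_iff, not_le] at h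
    exact hz (by simp only [hf.eq_zero h.le, zero_mul])

lemma tendsto_integral_radial (hf : IsTest f) (hK : ContinuousOn K (Ioi 0)) {x : Eucl d}
    (hx : 2 < ‖x‖) :
    Tendsto (fun ε : ℝ => ∫ z, f z * K (‖x - z‖ ^ 2 + ε ^ 2)) (𝓝[>] 0)
      (𝓝 (∫ z, f z * K (‖x - z‖ ^ 2))) := by
  obtain ⟨B, hB⟩ := (isCompact_Icc (a := (1 : ℝ)) (b := (‖x‖ + 1) ^ 2 + 1)).exists_bound_of_continuousOn
    (hK.mono fun ρ hρ => lt_of_lt_of_le one_pos hρ.1)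
  refine tendsto_integral_filter_of_dominated_convergence (fun z => ‖f z‖ * B)
    (Eventually.of_forall fun ε => (integrable_mul_radial hf hK hx (sq_nonneg ε)).aestronglyMeasurable)
    ?_ (hf.integrable.norm.mul_const B) (Eventually.of_forall fun z => ?_)
  · filter_upwards [Ioo_mem_nhdsGT (zero_lt_one' ℝ)] with ε hε
    refine Eventually.of_forall fun z => ?_
    rcases le_or_gt 1 ‖z‖ with h | h
    · rw [hf.eq_zero h]; simp
    · have h1 := norm_sub_sq_mem hx (mem_closedBall_zero_iff.2 h.le)
      rw [norm_mul]
      refine mul_le_mul_of_nonneg_left (hB _ ⟨by linarith [h1.1, sq_nonneg ε], ?_⟩) (norm_nonneg _)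
      have : ε ^ 2 ≤ 1 := pow_le_one₀ hε.1.le hε.2.le
      linarith [h1.2]
  · rcases le_or_gt 1 ‖z‖ with h | h
    · simp [hf.eq_zero h]
    · have h1 := (norm_sub_sq_mem hx (mem_closedBall_zero_iff.2 h.le)).1
      have h2 : ContinuousAt K (‖x - z‖ ^ 2) := hK.continuousAt (Ioi_mem_nhds (by linarith))
      have h3 : Tendsto (fun ε : ℝ => ‖x - z‖ ^ 2 + ε ^ 2) (𝓝[>] 0) (𝓝 (‖x - z‖ ^ 2)) := by
        have : Continuous fun ε : ℝ => ‖x - z‖ ^ 2 + ε ^ 2 := by fun_prop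
        simpa using (this.tendsto 0).mono_left nhdsWithin_le_nhds
      exact (h2.tendsto.comp h3).const_mul _

lemma hasFDerivAt_integral_radial (hf : IsTest f) (hK : ∀ ρ, 0 < ρ → HasDerivAt K (K' ρ) ρ)
    (hK' : ContinuousOn K' (Ioi 0)) {x : Eucl d} (hx : 2 < ‖x‖) :
    ∃ L : Eucl d →L[ℝ] ℝ, HasFDerivAt (fun ξ => ∫ z, f z * K (‖ξ - z‖ ^ 2)) L x ∧
      ∀ v, L v = ∫ z in Metric.closedBall (0 : Eucl d) 1,
        f z * K' (‖x - z‖ ^ 2) * (2 * inner ℝ (x - z) v) := by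
  have hKc : ContinuousOn K (Ioi 0) := fun ρ hρ => (hK ρ hρ).continuousAt.continuousWithinAt
  obtain ⟨M, hM0, hM⟩ := hf.bounded
  obtain ⟨B, hB⟩ := (isCompact_Icc (a := (1 : ℝ)) (b := (‖x‖ + 2) ^ 2)).exists_bound_of_continuousOn
    (hK'.mono fun ρ hρ => lt_of_lt_of_le one_pos hρ.1)
  have hB0 : 0 ≤ B := (norm_nonneg _).trans (hB 1 ⟨le_rfl, one_le_pow₀ (by linarith)⟩)
  set F' : Eucl d → Eucl d → Eucl d →L[ℝ] ℝ := fun ξ z =>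
    (f z * K' (‖ξ - z‖ ^ 2)) • ((2 : ℝ) • innerSL ℝ (ξ - z)) with hF'
  -- On U, with ‖z‖ ≤ 1, the squared distance stays in [1, (‖x‖ + 2)²], a compact subset of (0, ∞)
  -- on which `K'` is bounded.
  set U : Set (Eucl d) := {ξ | 2 < ‖ξ‖ ∧ ‖ξ‖ < ‖x‖ + 1} with hU
  have hUo : U ∈ 𝓝 x := ((isOpen_lt continuous_const continuous_norm).inter
    (isOpen_lt continuous_norm continuous_const)).mem_nhds ⟨hx, lt_add_one ‖x‖⟩
  have hc0 : ∀ ξ : Eucl d, 2 < ‖ξ‖ →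
      ContinuousOn (fun z => f z * K (‖ξ - z‖ ^ 2)) (Metric.closedBall 0 1) := fun ξ hξ => by
    simpa using continuousOn_mul_radial hf hKc hξ le_rfl
  have hc1 : ContinuousOn (fun z => f z * K' (‖x - z‖ ^ 2)) (Metric.closedBall 0 1) := by
    simpa using continuousOn_mul_radial hf hK' hx le_rfl
  have hF'c : ContinuousOn (F' x) (Metric.closedBall 0 1) :=
    hc1.smul (Continuous.continuousOn (by fun_prop))
  have hmain := hasFDerivAt_integral_of_dominated_of_fderiv_le
    (μ := volume.restrict (Metric.closedBall (0 : Eucl d) 1)) (x₀ := x) (s := U)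
    (F := fun ξ z => f z * K (‖ξ - z‖ ^ 2)) (F' := F')
    (bound := fun _ => M * B * (2 * (‖x‖ + 2))) hUo
    (by
      filter_upwards [hUo] with ξ hξ
      exact (hc0 ξ hξ.1).aestronglyMeasurable Metric.isClosed_closedBall.measurableSet)
    ((hc0 x hx).integrableOn_compact (isCompact_closedBall _ _))
    (hF'c.aestronglyMeasurable Metric.isClosed_closedBall.measurableSet) ?_
    (by
      have : IsFiniteMeasure (volume.restrict (Metric.closedBall (0 : Eucl d) 1)) :=
        isFiniteMeasure_restrict.2 (isCompact_closedBall _ _).measure_lt_top.ne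
      exact integrable_const _) ?_
  · refine ⟨∫ z in Metric.closedBall (0 : Eucl d) 1, F' x z, ?_, fun v => ?_⟩
    · simp_rw [hf.integral_mul_eq]
      exact hmain
    · rw [ContinuousLinearMap.integral_apply
        (hF'c.integrableOn_compact (isCompact_closedBall _ _))]
      simp [hF', inner_sub_left]
  · refine (ae_restrict_iff' Metric.isClosed_closedBall.measurableSet).2
      (Eventually.of_forall fun z hz ξ hξ => ?_)
    have h1 := norm_sub_sq_mem hξ.1 hz
    have h2 : ‖K' (‖ξ - z‖ ^ 2)‖ ≤ B :=
      hB _ ⟨h1.1, h1.2.trans (pow_le_pow_left₀ (by positivity) (by linarith [hξ.2]) 2)⟩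
    rw [mem_closedBall_zero_iff] at hz
    have h3 : ‖ξ - z‖ ≤ ‖x‖ + 2 := (norm_sub_le _ _).trans (by linarith [hξ.2])
    rw [hF']
    simp only [norm_smul, norm_mul, innerSL_apply_norm, Real.norm_ofNat]
    exact mul_le_mul (mul_le_mul (hM z) h2 (norm_nonneg _) hM0) (by linarith) (by positivity)
      (by positivity)
  · refine (ae_restrict_iff' Metric.isClosed_closedBall.measurableSet).2
      (Eventually.of_forall fun z hz ξ hξ => ?_)
    have h1 := norm_sub_sq_mem hξ.1 hz
    have h2 : HasFDerivAt (fun ξ => ‖ξ - z‖ ^ 2) ((2 : ℝ) • innerSL ℝ (ξ - z)) ξ := by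
      have := (hasStrictFDerivAt_norm_sq (ξ - z)).hasFDerivAt.comp ξ
        ((hasFDerivAt_id ξ).sub_const z)
      refine this.congr_fderiv ?_
      ext v
      simp
    have h3 := ((hK _ (lt_of_lt_of_le one_pos h1.1)).comp_hasFDerivAt ξ h2).const_mul (f z)
    refine h3.congr_fderiv ?_
    rw [hF', smul_smul]

/-- The reflection sending w to -w fixes x when w ⊥ x, so invariance forces L w = -L w. Hence only
the component of a direction along x contributes. -/
lemma fderiv_radial_apply {V : Eucl d → ℝ} {L : Eucl d →L[ℝ] ℝ} {x : Eucl d} (hx : x ≠ 0)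
    (hV : ∀ (R : Eucl d ≃ₗᵢ[ℝ] Eucl d) y, V (R y) = V y) (hL : HasFDerivAt V L x) (i : Fin d) :
    L (EuclideanSpace.single i 1) = x i / ‖x‖ ^ 2 * L x := by
  have hx2 : ‖x‖ ^ 2 ≠ 0 := by positivity
  -- The part of the i-th basis vector orthogonal to x.
  set w : Eucl d := EuclideanSpace.single i 1 - (x i / ‖x‖ ^ 2) • x with hw
  have hwx : inner ℝ w x = 0 := by
    rw [hw, inner_sub_left, inner_smul_left, real_inner_self_eq_norm_sq,
      EuclideanSpace.inner_single_left]
    simp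
    field_simp
    simp
  set R := (ℝ ∙ w)ᗮ.reflection with hR
  have hRx : R x = x := Submodule.reflection_mem_subspace_eq_self
    (Submodule.mem_orthogonal_singleton_iff_inner_right.2 hwx)
  have hRw : R w = -w := Submodule.reflection_orthogonalComplement_singleton_eq_neg w
  have h1 : HasFDerivAt (V ∘ R) (L ∘L (R.toContinuousLinearEquiv : Eucl d →L[ℝ] Eucl d)) x :=
    HasFDerivAt.comp x (by rw [hRx]; exact hL) R.toContinuousLinearEquiv.hasFDerivAt
  have h2 : V ∘ R = V := funext fun y => hV R y
  rw [h2] at h1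
  have h3 := congrArg (fun T : Eucl d →L[ℝ] ℝ => T w) (hL.unique h1)
  have h4 : L w = L (R w) := by simpa using h3
  rw [hRw, map_neg] at h4
  have h5 : L w = 0 := by linarith
  rw [hw, map_sub, map_smul, smul_eq_mul] at h5
  linarith

lemma integral_radial_comp_isometry {ψ : ℝ → ℝ} (a : ℝ) (K : ℝ → ℝ)
    (R : Eucl d ≃ₗᵢ[ℝ] Eucl d) (y : Eucl d) :
    ∫ z : Eucl d, a * ψ ‖z‖ * K (‖R y - z‖ ^ 2) = ∫ z : Eucl d, a * ψ ‖z‖ * K (‖y - z‖ ^ 2) := by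
  rw [← R.measurePreserving.integral_comp R.toHomeomorph.measurableEmbedding]
  congr 1; funext z
  rw [← map_sub, R.norm_map, R.norm_map]

/-- For ‖z‖ ≤ 1 one has ‖x - z‖ ≥ ‖x‖ - 1 and (x - z) · x ≥ ‖x‖² - ‖x‖ > 0, so the integrand is
nonnegative. It is strictly positive on the ball of radius 1/2, where ψ > 1. -/
lemma integral_radial_mul_inner_pos {a : ℝ} {ψ : ℝ → ℝ} (ha : 0 < a) (hψ : IsSpatialProfile d ψ)
    (hf : IsTest fun y : Eucl d => a * ψ ‖y‖) (hK' : ContinuousOn K' (Ioi 0)) {x : Eucl d}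
    (hx : 2 < ‖x‖) (hpos : ∀ ρ, (‖x‖ - 1) ^ 2 ≤ ρ → 0 < K' ρ) :
    0 < ∫ z in Metric.closedBall (0 : Eucl d) 1,
        a * ψ ‖z‖ * K' (‖x - z‖ ^ 2) * (2 * inner ℝ (x - z) x) := by
  have hfac : ∀ z ∈ Metric.closedBall (0 : Eucl d) 1,
      0 < K' (‖x - z‖ ^ 2) * (2 * inner ℝ (x - z) x) := by
    intro z hz
    rw [mem_closedBall_zero_iff] at hz
    have h1 := norm_sub_norm_le x z
    refine mul_pos (hpos _ (pow_le_pow_left₀ (by linarith) (by linarith) 2)) ?_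
    rw [inner_sub_left, real_inner_self_eq_norm_sq]
    have h2 := real_inner_le_norm z x
    nlinarith [mul_le_mul_of_nonneg_right hz (norm_nonneg x)]
  have hc : ContinuousOn (fun z => a * ψ ‖z‖ * K' (‖x - z‖ ^ 2) * (2 * inner ℝ (x - z) x))
      (Metric.closedBall 0 1) := by
    have := continuousOn_mul_radial hf hK' hx le_rfl
    simp only [add_zero] at this
    exact this.mul (Continuous.continuousOn (by fun_prop))
  rw [setIntegral_pos_iff_support_of_nonneg_ae ?_
    (hc.integrableOn_compact (isCompact_closedBall _ _))]
  · refine lt_of_lt_of_le (Metric.measure_ball_pos volume (0 : Eucl d) (show (0 : ℝ) < 1 / 2 by norm_num))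
      (measure_mono fun z hz => ?_)
    have hz1 : z ∈ Metric.closedBall (0 : Eucl d) 1 :=
      Metric.ball_subset_closedBall (Metric.ball_subset_ball (by norm_num) hz)
    refine ⟨?_, hz1⟩
    rw [Function.mem_support, mul_assoc]
    exact (mul_pos (mul_pos ha (zero_lt_one.trans (hψ.one_lt z hz))) (hfac z hz1)).ne'
  · refine (ae_restrict_iff' Metric.isClosed_closedBall.measurableSet).2
      (Eventually.of_forall fun z hz => ?_)
    simp only [Pi.zero_apply]
    rw [mul_assoc]
    exact mul_nonneg (mul_nonneg ha.le (hψ.nonneg z)) (hfac z hz).le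

end RadialPotential

/-! ### The boundary pressure -/

/-- The radial profile of the boundary pressure as a function of the squared distance. -/
def pressureProfile (d : ℕ) (φ : ℝ → ℝ) (t ρ : ℝ) : ℝ :=
  -2 * φ t * (newtonConst d * ρ ^ (-((d : ℝ) + 1) / 2)) - 2 * deriv φ t * newtonRadial d ρ
    - 2 * (potConst d * ∫ y : Eucl d, poissonWeight y) * heatRadial (((d : ℝ) + 3) / 2) φ t ρ

/-- The derivative of `pressureProfile` in the squared distance. -/
def pressureProfileDeriv (d : ℕ) (φ : ℝ → ℝ) (t ρ : ℝ) : ℝ :=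
  φ t * (newtonConst d * ((d : ℝ) + 1)) * ρ ^ (-((d : ℝ) + 3) / 2)
    - deriv φ t * newtonConst d * ρ ^ (-((d : ℝ) + 1) / 2)
    + 1 / 2 * (potConst d * ∫ y : Eucl d, poissonWeight y)
      * heatRadial (((d : ℝ) + 5) / 2) φ t ρ

section Pressure

variable {d : ℕ} {a : ℝ} {ψ φ : ℝ → ℝ} {t : ℝ}

lemma hasDerivAt_pressureProfile (hφ : ContinuousOn φ (Ico 0 2)) (ht : t ∈ Ioo (0 : ℝ) 2) {ρ : ℝ}
    (hρ : 0 < ρ) :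
    HasDerivAt (pressureProfile d φ t) (pressureProfileDeriv d φ t ρ) ρ := by
  have h1 := ((Real.hasDerivAt_rpow_const (x := ρ) (p := -((d : ℝ) + 1) / 2)
    (Or.inl hρ.ne')).const_mul (newtonConst d)).const_mul (-2 * φ t)
  have h2 := (hasDerivAt_newtonRadial d hρ).const_mul (2 * deriv φ t)
  have h3 := (hasDerivAt_heatRadial (m := ((d : ℝ) + 3) / 2) (by positivity) hφ ht hρ).const_mul
    (2 * (potConst d * ∫ y : Eucl d, poissonWeight y))
  refine ((h1.sub h2).sub h3).congr_deriv ?_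
  rw [pressureProfileDeriv, show -((d : ℝ) + 1) / 2 - 1 = -((d : ℝ) + 3) / 2 by ring,
    show ((d : ℝ) + 3) / 2 + 1 = ((d : ℝ) + 5) / 2 by ring]
  ring

lemma continuousOn_pressureProfileDeriv (hφ : ContinuousOn φ (Ico 0 2)) (ht : t ∈ Ioo (0 : ℝ) 2) :
    ContinuousOn (pressureProfileDeriv d φ t) (Ioi 0) :=
  ((continuousOn_const.mul (continuousOn_rpow_Ioi _)).sub
    (continuousOn_const.mul (continuousOn_rpow_Ioi _))).add
    (continuousOn_const.mul (continuousOn_heatRadial (by positivity) hφ ht))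

lemma IsSpatialProfile.isTest (hψ : IsSpatialProfile d ψ) (a : ℝ) :
    IsTest fun y : Eucl d => a * ψ ‖y‖ := by
  refine ⟨contDiff_const.mul hψ.smooth, Subset.trans ?_ hψ.supp⟩
  exact closure_mono fun y hy h => hy (by simp only [h, mul_zero])

/-- The data are normal, so only j = n survives in both sums. The term with ε² comes from the second
normal derivative of N and disappears in the boundary limit. -/
lemma stokesPressure_bdryData (hψ : IsSpatialProfile d ψ) (hφ : ContinuousOn φ (Ico 0 2))
    (ht : t ∈ Ioo (0 : ℝ) 2) {x : Eucl d} (hx : 2 < ‖x‖) {ε : ℝ} (hε : 0 < ε) :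
    stokesPressure (bdryData d a ψ φ) (bpt x ε) t
      = -2 * (φ t * (newtonConst d *
          ((∫ z : Eucl d, a * ψ ‖z‖ * (‖x - z‖ ^ 2 + ε ^ 2) ^ (-((d : ℝ) + 1) / 2))
          - ((d : ℝ) + 1) * ε ^ 2 *
            ∫ z : Eucl d, a * ψ ‖z‖ * (‖x - z‖ ^ 2 + ε ^ 2) ^ (-((d : ℝ) + 3) / 2))))
        - 2 * (deriv φ t * ∫ z : Eucl d, a * ψ ‖z‖ * newtonRadial d (‖x - z‖ ^ 2 + ε ^ 2))
        + 4 * (potConst d * (deriv (fun r => convPot φ (fun y => a * ψ ‖y‖) x ε r) t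
          - convPot φ (laplacian fun y => a * ψ ‖y‖) x ε t)) := by
  have hf := hψ.isTest a
  have hI : ∀ r : ℝ, Integrable fun z : Eucl d => a * ψ ‖z‖ * (‖x - z‖ ^ 2 + ε ^ 2) ^ r :=
    fun r => integrable_mul_radial (K := fun ρ => ρ ^ r) hf (continuousOn_rpow_Ioi r) hx
      (sq_nonneg ε)
  rw [stokesPressure]
  congr 1
  · congr 1
    · congr 1
      rw [Fin.sum_univ_castSucc]
      simp only [bdryData_castSucc, mul_zero, integral_zero, Finset.sum_const_zero, zero_add,
        tang_bpt, normal_bpt, bdryData_last, pderiv_last_pderiv_last_newton _ _ hε]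
      rw [← integral_const_mul, ← integral_sub (hI _) ((hI _).const_mul _), ← integral_const_mul,
        ← integral_const_mul]
      congr 1; funext z; ring
    · congr 1
      simp only [tang_bpt, normal_bpt, bdryData_last, newton_eq_newtonRadial, norm_sq_bpt]
      have h1 : ∀ r, ∫ y : Eucl d, newtonRadial d (‖x - y‖ ^ 2 + ε ^ 2) * (a * ψ ‖y‖ * φ r)
          = φ r * ∫ z : Eucl d, a * ψ ‖z‖ * newtonRadial d (‖x - z‖ ^ 2 + ε ^ 2) := by
        intro r
        rw [← integral_const_mul]
        congr 1; funext z; ring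
      simp_rw [h1]
      exact deriv_mul_const_field _
  · congr 1
    rw [Fin.sum_univ_castSucc]
    have h1 : ∀ i : Fin d, deriv (fun r => heatPotential (bdryData d a ψ φ) i.castSucc (bpt x ε) r) t
        - tangLaplacian (fun ξ => heatPotential (bdryData d a ψ φ) i.castSucc ξ t) (bpt x ε)
        = 0 := by
      intro i
      simp [heatPotential_castSucc, tangLaplacian, pderiv, lineDeriv]
    simp only [h1, Finset.sum_const_zero, zero_add]
    rw [tangLaplacian_heatPotential_last hφ hf x hε ht, mul_sub]
    congr 1
    have h2 : (fun r => heatPotential (bdryData d a ψ φ) (Fin.last d) (bpt x ε) r) =ᶠ[𝓝 t]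
        fun r => potConst d * convPot φ (fun y => a * ψ ‖y‖) x ε r := by
      filter_upwards [Ioi_mem_nhds ht.1] with r hr
      exact heatPotential_last hf x hε hr
    rw [h2.deriv_eq]
    exact deriv_const_mul_field _

lemma tendsto_stokesPressure (hψ : IsSpatialProfile d ψ) (hφ : ContinuousOn φ (Ico 0 2))
    {l r : ℝ} (hl : 0 ≤ l) (hr : r ≤ 2) (hφ1 : ContDiffOn ℝ 1 φ (Ioo l r)) (ht : t ∈ Ioo l r)
    {x : Eucl d} (hx : 2 < ‖x‖) :
    Tendsto (fun ε => stokesPressure (bdryData d a ψ φ) (bpt x ε) t) (𝓝[>] 0)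
      (𝓝 (∫ z : Eucl d, a * ψ ‖z‖ * pressureProfile d φ t (‖x - z‖ ^ 2))) := by
  have hf := hψ.isTest a
  have ht2 : t ∈ Ioo (0 : ℝ) 2 := ⟨hl.trans_lt ht.1, ht.2.trans_le hr⟩
  -- The window of half-width 2δ on which φ is differentiated must lie in (l, r), where φ is C¹; the
  -- intervals (0, 1) and (1, 2) are treated at once.
  obtain ⟨δ, hδ0, hδl, hδr⟩ : ∃ δ, 0 < δ ∧ l < t - 2 * δ ∧ t + 2 * δ < r := by
    refine ⟨min (t - l) (r - t) / 4, ?_, ?_, ?_⟩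
    · have := lt_min (sub_pos.2 ht.1) (sub_pos.2 ht.2); linarith
    · have h1 := min_le_left (t - l) (r - t); have h2 := ht.1; linarith
    · have h1 := min_le_right (t - l) (r - t); have h2 := ht.2; linarith
  have hsub : Icc (t - 2 * δ) (t + 2 * δ) ⊆ Ioo l r := fun u hu =>
    ⟨hδl.trans_le hu.1, hu.2.trans_lt hδr⟩
  have h1 := tendsto_deriv_convPot_sub_laplacian (φ' := deriv φ) hδ0 (by linarith) (by linarith) hφ
    (fun u hu => ((hφ1.differentiableOn one_ne_zero).differentiableAt
      (isOpen_Ioo.mem_nhds (hsub hu))).hasDerivAt)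
    ((hφ1.continuousOn_deriv_of_isOpen isOpen_Ioo le_rfl).mono hsub) hf hx
  rw [integral_smear_zero_eq hφ hf hx ht2] at h1
  have h2 := tendsto_integral_radial hf (continuousOn_newtonRadial d) hx
  have h3 := tendsto_integral_radial (K := fun ρ => ρ ^ (-((d : ℝ) + 1) / 2)) hf
    (continuousOn_rpow_Ioi _) hx
  have h4 := tendsto_integral_radial (K := fun ρ => ρ ^ (-((d : ℝ) + 3) / 2)) hf
    (continuousOn_rpow_Ioi _) hx
  have h5 : Tendsto (fun ε : ℝ => ((d : ℝ) + 1) * ε ^ 2) (𝓝[>] 0) (𝓝 0) := by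
    have : Continuous fun ε : ℝ => ((d : ℝ) + 1) * ε ^ 2 := by fun_prop
    simpa using (this.tendsto 0).mono_left nhdsWithin_le_nhds
  have h6 := ((((((h3.sub (h5.mul h4)).const_mul (newtonConst d)).const_mul (φ t)).const_mul
    (-2)).sub ((h2.const_mul (deriv φ t)).const_mul 2))).add ((h1.const_mul (potConst d)).const_mul 4)
  have hval : ∫ z : Eucl d, a * ψ ‖z‖ * pressureProfile d φ t (‖x - z‖ ^ 2)
      = -2 * (φ t * (newtonConst d *
          ((∫ z : Eucl d, a * ψ ‖z‖ * (‖x - z‖ ^ 2) ^ (-((d : ℝ) + 1) / 2))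
          - 0 * ∫ z : Eucl d, a * ψ ‖z‖ * (‖x - z‖ ^ 2) ^ (-((d : ℝ) + 3) / 2))))
        - 2 * (deriv φ t * ∫ z : Eucl d, a * ψ ‖z‖ * newtonRadial d (‖x - z‖ ^ 2))
        + 4 * (potConst d * (-(1 / 2) * ((∫ y : Eucl d, poissonWeight y)
          * ∫ z : Eucl d, a * ψ ‖z‖ * heatRadial (((d : ℝ) + 3) / 2) φ t (‖x - z‖ ^ 2)))) := by
    have hI : ∀ K : ℝ → ℝ, ContinuousOn K (Ioi 0) →
        Integrable fun z : Eucl d => a * ψ ‖z‖ * K (‖x - z‖ ^ 2) := fun K hK => by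
      simpa using integrable_mul_radial hf hK hx le_rfl
    have i1 := (hI (fun ρ => ρ ^ (-((d : ℝ) + 1) / 2)) (continuousOn_rpow_Ioi _)).const_mul
      (-2 * φ t * newtonConst d)
    have i2 := (hI _ (continuousOn_newtonRadial d)).const_mul (2 * deriv φ t)
    have i3 := (hI _ (continuousOn_heatRadial (m := ((d : ℝ) + 3) / 2) (by positivity) hφ
      ht2)).const_mul (2 * (potConst d * ∫ y : Eucl d, poissonWeight y))
    have h7 := integral_sub (i1.sub i2) i3
    simp only [Pi.sub_apply] at h7
    rw [integral_sub i1 i2, integral_const_mul, integral_const_mul, integral_const_mul] at h7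
    have h8 : ∫ z : Eucl d, a * ψ ‖z‖ * pressureProfile d φ t (‖x - z‖ ^ 2)
        = ∫ z : Eucl d, (-2 * φ t * newtonConst d
            * (a * ψ ‖z‖ * (‖x - z‖ ^ 2) ^ (-((d : ℝ) + 1) / 2))
          - 2 * deriv φ t * (a * ψ ‖z‖ * newtonRadial d (‖x - z‖ ^ 2))
          - 2 * (potConst d * ∫ y : Eucl d, poissonWeight y)
            * (a * ψ ‖z‖ * heatRadial (((d : ℝ) + 3) / 2) φ t (‖x - z‖ ^ 2))) := by
      congr 1; funext z; rw [pressureProfile]; ring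
    rw [h8, h7]
    ring
  rw [hval]
  refine h6.congr' ?_
  filter_upwards [self_mem_nhdsWithin] with ε hε
  exact (stokesPressure_bdryData hψ hφ ht2 hx hε).symm

lemma boundaryPressure_eq (hψ : IsSpatialProfile d ψ) (hφ : ContinuousOn φ (Ico 0 2))
    {l r : ℝ} (hl : 0 ≤ l) (hr : r ≤ 2) (hφ1 : ContDiffOn ℝ 1 φ (Ioo l r)) (ht : t ∈ Ioo l r)
    {x : Eucl d} (hx : 2 < ‖x‖) :
    boundaryPressure (bdryData d a ψ φ) x t
      = ∫ z : Eucl d, a * ψ ‖z‖ * pressureProfile d φ t (‖x - z‖ ^ 2) :=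
  (tendsto_stokesPressure hψ hφ hl hr hφ1 ht hx).limUnder_eq

lemma boundaryPressure_eventuallyEq (hψ : IsSpatialProfile d ψ) (hφ : ContinuousOn φ (Ico 0 2))
    {l r : ℝ} (hl : 0 ≤ l) (hr : r ≤ 2) (hφ1 : ContDiffOn ℝ 1 φ (Ioo l r)) (ht : t ∈ Ioo l r)
    {x : Eucl d} (hx : 2 < ‖x‖) :
    (fun y => boundaryPressure (bdryData d a ψ φ) y t) =ᶠ[𝓝 x]
      fun y => ∫ z : Eucl d, a * ψ ‖z‖ * pressureProfile d φ t (‖y - z‖ ^ 2) := by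
  filter_upwards [(isOpen_lt continuous_const continuous_norm).mem_nhds hx] with y hy
  exact boundaryPressure_eq hψ hφ hl hr hφ1 ht hy

lemma hasBoundaryPressure_bdryData (hψ : IsSpatialProfile d ψ) (hφ : ContinuousOn φ (Ico 0 2))
    {l r : ℝ} (hl : 0 ≤ l) (hr : r ≤ 2) (hφ1 : ContDiffOn ℝ 1 φ (Ioo l r)) (ht : t ∈ Ioo l r)
    {x : Eucl d} (hx : 2 < ‖x‖) :
    HasBoundaryPressure (bdryData d a ψ φ) x t := by
  have ht2 : t ∈ Ioo (0 : ℝ) 2 := ⟨hl.trans_lt ht.1, ht.2.trans_le hr⟩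
  refine ⟨?_, ?_⟩
  · filter_upwards [(isOpen_lt continuous_const continuous_norm).mem_nhds hx] with y hy
    rw [boundaryPressure_eq hψ hφ hl hr hφ1 ht hy]
    exact tendsto_stokesPressure hψ hφ hl hr hφ1 ht hy
  · obtain ⟨L, hL, -⟩ := hasFDerivAt_integral_radial (hψ.isTest a)
      (fun ρ hρ => hasDerivAt_pressureProfile (d := d) hφ ht2 hρ)
      (continuousOn_pressureProfileDeriv hφ ht2) hx
    exact (hL.congr_of_eventuallyEq
      (boundaryPressure_eventuallyEq hψ hφ hl hr hφ1 ht hx)).differentiableAt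

/-- Differentiating directly would leave the factor (x - z)_i, which can change sign on the support
when x_i is small. Passing through the radial derivative replaces it by (x - z) · x > 0, so any x_i
> 0 is admissible. -/
lemma tangPressureDeriv_eq (hψ : IsSpatialProfile d ψ) (hφ : ContinuousOn φ (Ico 0 2))
    {l r : ℝ} (hl : 0 ≤ l) (hr : r ≤ 2) (hφ1 : ContDiffOn ℝ 1 φ (Ioo l r)) (ht : t ∈ Ioo l r)
    {x : Eucl d} (hx : 2 < ‖x‖) (i : Fin d) :
    tangPressureDeriv (bdryData d a ψ φ) i x t = x i / ‖x‖ ^ 2 *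
      ∫ z in Metric.closedBall (0 : Eucl d) 1,
        a * ψ ‖z‖ * pressureProfileDeriv d φ t (‖x - z‖ ^ 2) * (2 * inner ℝ (x - z) x) := by
  have ht2 : t ∈ Ioo (0 : ℝ) 2 := ⟨hl.trans_lt ht.1, ht.2.trans_le hr⟩
  obtain ⟨L, hL, hLv⟩ := hasFDerivAt_integral_radial (hψ.isTest a)
    (fun ρ hρ => hasDerivAt_pressureProfile (d := d) hφ ht2 hρ)
    (continuousOn_pressureProfileDeriv hφ ht2) hx
  have hx0 : x ≠ 0 := by rintro rfl; norm_num at hx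
  have h1 := hL.congr_of_eventuallyEq (boundaryPressure_eventuallyEq hψ hφ hl hr hφ1 ht hx)
  rw [tangPressureDeriv, pderiv, h1.differentiableAt.lineDeriv_eq_fderiv, h1.fderiv,
    fderiv_radial_apply hx0
      (fun R y => integral_radial_comp_isometry a (pressureProfile d φ t) R y) hL i, hLv]

lemma tangPressureDeriv_pos (ha : 0 < a) (hψ : IsSpatialProfile d ψ)
    (hφ : ContinuousOn φ (Ico 0 2))
    {l r : ℝ} (hl : 0 ≤ l) (hr : r ≤ 2) (hφ1 : ContDiffOn ℝ 1 φ (Ioo l r)) (ht : t ∈ Ioo l r)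
    {x : Eucl d} (hx : 2 < ‖x‖) {i : Fin d} (hi : 0 < x i)
    (hpos : ∀ ρ, (‖x‖ - 1) ^ 2 ≤ ρ → 0 < pressureProfileDeriv d φ t ρ) :
    0 < tangPressureDeriv (bdryData d a ψ φ) i x t := by
  have ht2 : t ∈ Ioo (0 : ℝ) 2 := ⟨hl.trans_lt ht.1, ht.2.trans_le hr⟩
  rw [tangPressureDeriv_eq hψ hφ hl hr hφ1 ht hx]
  refine mul_pos (div_pos hi (by positivity)) ?_
  exact integral_radial_mul_inner_pos ha hψ (hψ.isTest a)
    (continuousOn_pressureProfileDeriv hφ ht2) hx hpos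

lemma tangPressureDeriv_neg (ha : 0 < a) (hψ : IsSpatialProfile d ψ)
    (hφ : ContinuousOn φ (Ico 0 2))
    {l r : ℝ} (hl : 0 ≤ l) (hr : r ≤ 2) (hφ1 : ContDiffOn ℝ 1 φ (Ioo l r)) (ht : t ∈ Ioo l r)
    {x : Eucl d} (hx : 2 < ‖x‖) {i : Fin d} (hi : 0 < x i)
    (hneg : ∀ ρ, (‖x‖ - 1) ^ 2 ≤ ρ → pressureProfileDeriv d φ t ρ < 0) :
    tangPressureDeriv (bdryData d a ψ φ) i x t < 0 := by
  have ht2 : t ∈ Ioo (0 : ℝ) 2 := ⟨hl.trans_lt ht.1, ht.2.trans_le hr⟩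
  rw [tangPressureDeriv_eq hψ hφ hl hr hφ1 ht hx]
  refine mul_neg_of_pos_of_neg (div_pos hi (by positivity)) ?_
  have h1 := integral_radial_mul_inner_pos (K' := fun ρ => -pressureProfileDeriv d φ t ρ) ha hψ
    (hψ.isTest a) (continuousOn_pressureProfileDeriv hφ ht2).neg hx
    (fun ρ hρ => neg_pos.2 (hneg ρ hρ))
  simp only [mul_neg, neg_mul, integral_neg] at h1
  exact neg_pos.1 h1

/-! ### The sign of the profile derivative -/

lemma IsTemporalProfile.continuousOn (hφ : IsTemporalProfile φ) : ContinuousOn φ (Ico 0 2) := by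
  obtain ⟨α, C, -, -, h⟩ := hφ.holder
  exact h.continuousOn (by positivity)

lemma pressureProfileDeriv_pos_of_deriv_eq_zero (hφ : IsTemporalProfile φ)
    (ht : t ∈ Ioo (0 : ℝ) 1) (h0 : deriv φ t = 0) {ρ : ℝ} (hρ : 0 < ρ) :
    0 < pressureProfileDeriv d φ t ρ := by
  rw [pressureProfileDeriv, h0]
  have h1 := hφ.pos t ht
  have h2 := newtonConst_pos d
  have h3 := potConst_pos d
  have h4 := integral_poissonWeight_pos (d := d)
  have h5 := heatRadial_nonneg (m := ((d : ℝ) + 5) / 2) ht.1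
    (fun s hs => (hφ.pos s ⟨hs.1, hs.2.trans ht.2⟩).le) ρ
  have h6 := Real.rpow_pos_of_pos hρ (-((d : ℝ) + 3) / 2)
  have h7 : 0 < φ t * (newtonConst d * ((d : ℝ) + 1)) * ρ ^ (-((d : ℝ) + 3) / 2) := by positivity
  have h8 : 0 ≤ 1 / 2 * (potConst d * ∫ y : Eucl d, poissonWeight y)
      * heatRadial (((d : ℝ) + 5) / 2) φ t ρ := by positivity
  linarith

/-- Here φ and φ' may both vanish; strictness comes from the heat term, which remembers the inflow
before time 1. -/
lemma pressureProfileDeriv_pos_of_one_lt (hφ : IsTemporalProfile φ)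
    (ht : t ∈ Ioo (1 : ℝ) 2) {ρ : ℝ} (hρ : 0 < ρ) :
    0 < pressureProfileDeriv d φ t ρ := by
  rw [pressureProfileDeriv]
  have h0 : deriv φ t ≤ 0 := by
    rw [← derivWithin_of_isOpen isOpen_Ioo ht]
    exact hφ.anti.derivWithin_nonpos
  have h1 := hφ.nonneg t ht
  have h2 := newtonConst_pos d
  have h3 := potConst_pos d
  have h4 := integral_poissonWeight_pos (d := d)
  have h5 := heatRadial_pos (m := ((d : ℝ) + 5) / 2) (by positivity) hφ.continuousOn ht hφ.pos
    hφ.nonneg hρ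
  have h6 := Real.rpow_pos_of_pos hρ (-((d : ℝ) + 3) / 2)
  have h6' := Real.rpow_pos_of_pos hρ (-((d : ℝ) + 1) / 2)
  have h7 : 0 ≤ φ t * (newtonConst d * ((d : ℝ) + 1)) * ρ ^ (-((d : ℝ) + 3) / 2) := by positivity
  have h8 : 0 < 1 / 2 * (potConst d * ∫ y : Eucl d, poissonWeight y)
      * heatRadial (((d : ℝ) + 5) / 2) φ t ρ := by positivity
  have h9 : deriv φ t * newtonConst d * ρ ^ (-((d : ℝ) + 1) / 2) ≤ 0 :=
    mul_nonpos_of_nonpos_of_nonneg (mul_nonpos_of_nonpos_of_nonneg h0 h2.le) h6'.le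
  linarith

/-- The constant controlling the zeroth order terms of the profile by the derivative term. -/
def profileConst (d : ℕ) : ℝ :=
  (d : ℝ) + 1 + 1 / 2 * (potConst d * ∫ y : Eucl d, poissonWeight y) / newtonConst d
    * (4 * (((d : ℝ) + 5) / 2)) ^ (((d : ℝ) + 5) / 2)

lemma profileConst_pos (d : ℕ) : 0 < profileConst d := by
  have h2 := newtonConst_pos d
  have h3 := potConst_pos d
  have h4 := integral_poissonWeight_pos (d := d)
  unfold profileConst
  positivity

/-- The positive terms are together at most φ(t) `profileConst` / ρ times the coefficient of φ'(t).
Since t < 1, the hypothesis gives φ ≤ c φ', so the φ' term wins once ρ exceeds c `profileConst`. -/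
lemma pressureProfileDeriv_neg (hφ : IsTemporalProfile φ) (ht : t ∈ Ioo (0 : ℝ) 1) {c : ℝ}
    (hc : 0 < c) (h : φ t ≤ c * t * deriv φ t) {ρ : ℝ} (hρ1 : 1 ≤ ρ)
    (hρ : c * profileConst d < ρ) :
    pressureProfileDeriv d φ t ρ < 0 := by
  have hρ0 : 0 < ρ := by linarith
  have h1 := hφ.pos t ht
  have h2 := newtonConst_pos d
  have h3 := potConst_pos d
  have h4 := integral_poissonWeight_pos (d := d)
  set m : ℝ := ((d : ℝ) + 5) / 2 with hm
  have hm0 : 0 < m := by positivity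
  -- Monotonicity bounds the whole history by the present value φ(t).
  have h5 := heatRadial_le (φ := φ) hm0 ht.1 ht.2.le (A := φ t) (fun s hs => by
    have hs1 : s ∈ Ioo (0 : ℝ) 1 := ⟨hs.1, hs.2.trans ht.2⟩
    rw [abs_of_pos (hφ.pos s hs1)]
    exact hφ.mono hs1 ht hs.2.le) h1.le hρ0
  have hφ' : 0 < deriv φ t := by
    by_contra hn
    have : c * t * deriv φ t ≤ 0 :=
      mul_nonpos_of_nonneg_of_nonpos (mul_pos hc ht.1).le (not_lt.1 hn)
    linarith
  have h6 : φ t ≤ c * deriv φ t := by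
    refine h.trans (mul_le_mul_of_nonneg_right ?_ hφ'.le)
    exact mul_le_of_le_one_right hc.le ht.2.le
  set P := ρ ^ (-((d : ℝ) + 1) / 2) with hP
  have hP0 : 0 < P := Real.rpow_pos_of_pos hρ0 _
  have h7 : ρ ^ (-((d : ℝ) + 3) / 2) = P / ρ := by
    rw [hP, ← Real.rpow_sub_one hρ0.ne']; congr 1; ring
  -- The heat term decays one half power faster than needed; ρ ≥ 1 lets it be merged with the φ
  -- term.
  have h8 : ρ ^ (-m) ≤ P / ρ := by
    rw [← h7]
    exact Real.rpow_le_rpow_of_exponent_le hρ1 (by rw [hm]; linarith)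
  set Q := potConst d * ∫ y : Eucl d, poissonWeight y with hQ
  have hQ0 : 0 < Q := mul_pos h3 h4
  have h9 : 1 / 2 * Q * heatRadial m φ t ρ ≤ 1 / 2 * Q * (φ t * ((4 * m) ^ m * (P / ρ))) := by
    refine mul_le_mul_of_nonneg_left (h5.trans ?_) (by positivity)
    gcongr
  have h10 : φ t * (newtonConst d * ((d : ℝ) + 1)) * (P / ρ)
      + 1 / 2 * Q * (φ t * ((4 * m) ^ m * (P / ρ)))
      = newtonConst d * P * (φ t * profileConst d / ρ) := by
    rw [profileConst, ← hQ, ← hm]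
    field_simp
  have h11 : φ t * profileConst d / ρ < deriv φ t := by
    rw [div_lt_iff₀ hρ0]
    calc φ t * profileConst d ≤ c * deriv φ t * profileConst d :=
          mul_le_mul_of_nonneg_right h6 (profileConst_pos d).le
      _ = deriv φ t * (c * profileConst d) := by ring
      _ < deriv φ t * ρ := mul_lt_mul_of_pos_left hρ hφ'
  have h12 := mul_lt_mul_of_pos_left h11 (mul_pos h2 hP0)
  rw [pressureProfileDeriv, h7, ← hP, ← hQ, ← hm]
  linarith

/-! ### The time of sign change -/

lemma pressureTime_le {g : Eucl d → ℝ → Eucl (d + 1)} {i : Fin d} {x : Eucl d} {T : ℝ}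
    (hT : 0 ≤ T) (h : ∀ t, T < t → t < 2 → ∃ s ∈ Ioo 0 t, 0 ≤ tangPressureDeriv g i x s) :
    pressureTime g i x ≤ T := by
  -- The condition 0 ≤ T covers the empty set, whose supremum is 0.
  refine Real.sSup_le (fun t ht => ?_) hT
  by_contra hlt
  obtain ⟨s, hs, hs'⟩ := h t (not_le.1 hlt) ht.2.1
  exact absurd (ht.2.2 s hs) (not_lt.2 hs')

/-- This supplies the strict inequality t₁ < t*. The bound passes to t₁ by continuity; as φ(t₁) > 0,
doubling c makes it strict there, and it then persists slightly beyond t₁. -/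
lemma exists_gt_forall_le_of_le {c t₁ : ℝ} (hφ : IsTemporalProfile φ)
    (ht₁ : t₁ ∈ Ioo (0 : ℝ) 1) (h : ∀ t ∈ Ioo 0 t₁, φ t ≤ c * t * deriv φ t) :
    ∃ t₂ ∈ Ioo t₁ 1, ∀ t ∈ Ioo 0 t₂, φ t ≤ 2 * c * t * deriv φ t := by
  have hd : ContinuousAt (deriv φ) t₁ :=
    (hφ.contDiff.continuousOn_deriv_of_isOpen isOpen_Ioo le_rfl).continuousAt
      (isOpen_Ioo.mem_nhds ht₁)
  have hc0 : ContinuousAt φ t₁ := hφ.contDiff.continuousOn.continuousAt (isOpen_Ioo.mem_nhds ht₁)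
  have hle : φ t₁ ≤ c * t₁ * deriv φ t₁ := by
    refine le_of_tendsto_of_tendsto (b := 𝓝[<] t₁) (hc0.tendsto.mono_left nhdsWithin_le_nhds)
      (((continuousAt_const.mul continuousAt_id).mul hd).tendsto.mono_left nhdsWithin_le_nhds) ?_
    filter_upwards [Ioo_mem_nhdsLT ht₁.1] with t ht using h t ht
  have hpos := hφ.pos t₁ ht₁
  have hlt : φ t₁ < 2 * c * t₁ * deriv φ t₁ := by nlinarith
  have hev : ∀ᶠ t in 𝓝 t₁, φ t < 2 * c * t * deriv φ t :=
    hc0.eventually_lt ((continuousAt_const.mul continuousAt_id).mul hd) hlt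
  obtain ⟨η, hη, hball⟩ := Metric.eventually_nhds_iff.1 hev
  obtain ⟨t₂, h1, h2⟩ := exists_between (lt_min (lt_add_of_pos_right t₁ hη) ht₁.2)
  rw [lt_min_iff] at h2
  refine ⟨t₂, ⟨h1, h2.2⟩, fun t ht => ?_⟩
  rcases lt_or_ge t t₁ with htt | htt
  · have h3 := h t ⟨ht.1, htt⟩
    have h4 := hφ.pos t ⟨ht.1, htt.trans ht₁.2⟩
    nlinarith
  · refine (hball ?_).le
    rw [Real.dist_eq, abs_of_nonneg (by linarith)]
    linarith [ht.2]

end Pressure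

end HalfSpaceStokes

end

theorem theorem1p1 (d : ℕ) (hd : 1 ≤ d) :
    -- (i)
    (∀ c : ℝ, 0 < c → ∃ cStar : ℝ, 2 < cStar ∧
      ∀ (a : ℝ) (ψ φ : ℝ → ℝ), 0 < a → HalfSpaceStokes.IsSpatialProfile d ψ →
        HalfSpaceStokes.IsTemporalProfile φ →
      ∀ t₁ ∈ Ioo (0 : ℝ) 1, (∀ t ∈ Ioo 0 t₁, φ t ≤ c * t * deriv φ t) →
      ∀ c₁ : ℝ, 0 < c₁ → ∀ (i : Fin d) (x' : Eucl d), cStar < ‖x'‖ → ‖x'‖ < c₁ * x' i →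
        t₁ < HalfSpaceStokes.pressureTime (HalfSpaceStokes.bdryData d a ψ φ) i x') ∧
    (∀ (a : ℝ) (ψ φ : ℝ → ℝ), 0 < a → HalfSpaceStokes.IsSpatialProfile d ψ →
        HalfSpaceStokes.IsTemporalProfile φ →
      -- the boundary pressure and its gradient are well defined for `0 < t < 1`
      (∀ x' : Eucl d, 2 < ‖x'‖ → ∀ t ∈ Ioo (0 : ℝ) 1,
        HalfSpaceStokes.HasBoundaryPressure (HalfSpaceStokes.bdryData d a ψ φ) x' t) ∧
      -- (ii)
      (∀ (i : Fin d) (x' : Eucl d), 2 < ‖x'‖ → 0 < x' i →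
        ∀ t₂ ∈ Ioo (0 : ℝ) 1, deriv φ t₂ = 0 →
          HalfSpaceStokes.pressureTime (HalfSpaceStokes.bdryData d a ψ φ) i x' ≤ t₂) ∧
      -- (iii), with the resulting bound of the time by `1`
      (ContDiffOn ℝ 1 φ (Ioo 1 2) →
        (∀ x' : Eucl d, 2 < ‖x'‖ → ∀ t ∈ Ioo (1 : ℝ) 2,
          HalfSpaceStokes.HasBoundaryPressure (HalfSpaceStokes.bdryData d a ψ φ) x' t) ∧
        ∀ (i : Fin d) (x' : Eucl d), 2 < ‖x'‖ → 0 < x' i →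
          (∀ t ∈ Ioo (1 : ℝ) 2,
            0 < HalfSpaceStokes.tangPressureDeriv (HalfSpaceStokes.bdryData d a ψ φ) i x' t) ∧
          HalfSpaceStokes.pressureTime (HalfSpaceStokes.bdryData d a ψ φ) i x' ≤ 1)) := by
  open HalfSpaceStokes in
  refine ⟨fun c hc => ?_, fun a ψ φ ha hψ hφ => ⟨?_, ?_, ?_⟩⟩
  · have hK := profileConst_pos d
    -- The factor 2c is the constant after the extension past t₁. Then ‖x'‖ - 1 > 2 + 2c
    -- `profileConst`, and ρ ≥ (‖x'‖ - 1)² ≥ ‖x'‖ - 1 meets both thresholds of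
    -- `pressureProfileDeriv_neg`.
    refine ⟨3 + 2 * c * profileConst d, by nlinarith [mul_pos hc hK], ?_⟩
    intro a ψ φ ha hψ hφ t₁ ht₁ h c₁ hc₁ i x' hx hxi
    have hxn : 3 + 2 * c * profileConst d < ‖x'‖ := hx
    have hcK : 0 < 2 * c * profileConst d := by positivity
    -- The cone condition enters only through the sign of x_i, so the radius does not depend on c₁.
    have hi : 0 < x' i := by
      have h1 : 0 < c₁ * x' i := (norm_nonneg x').trans_lt hxi
      exact pos_of_mul_pos_right h1 hc₁.le
    obtain ⟨t₂, ht₂, h₂⟩ := exists_gt_forall_le_of_le hφ ht₁ h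
    have hneg : ∀ s ∈ Ioo 0 t₂, tangPressureDeriv (bdryData d a ψ φ) i x' s < 0 := by
      intro s hs
      have hs1 : s ∈ Ioo (0 : ℝ) 1 := ⟨hs.1, hs.2.trans ht₂.2⟩
      refine tangPressureDeriv_neg ha hψ hφ.continuousOn le_rfl one_le_two hφ.contDiff hs1
        (by linarith) hi fun ρ hρ => ?_
      have h3 : ‖x'‖ - 1 ≤ (‖x'‖ - 1) ^ 2 := by nlinarith
      exact pressureProfileDeriv_neg hφ hs1 (by positivity) (h₂ s hs) (by linarith) (by linarith)
    refine ht₂.1.trans_le (le_csSup ⟨2, fun t ht => ht.2.1.le⟩ ⟨ht₁.1.trans ht₂.1, ?_, hneg⟩)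
    linarith [ht₂.2]
  · intro x' hx t ht
    exact hasBoundaryPressure_bdryData hψ hφ.continuousOn le_rfl one_le_two hφ.contDiff ht hx
  · intro i x' hx hi t₂ ht₂ h0
    refine pressureTime_le ht₂.1.le fun t ht _ => ⟨t₂, ⟨ht₂.1, ht⟩, ?_⟩
    refine (tangPressureDeriv_pos ha hψ hφ.continuousOn le_rfl one_le_two hφ.contDiff ht₂ hx hi
      fun ρ hρ => ?_).le
    exact pressureProfileDeriv_pos_of_deriv_eq_zero hφ ht₂ h0
      (lt_of_lt_of_le (pow_pos (by linarith) 2) hρ)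
  · intro hφ2
    refine ⟨fun x' hx t ht => hasBoundaryPressure_bdryData hψ hφ.continuousOn zero_le_one le_rfl
      hφ2 ht hx, fun i x' hx hi => ?_⟩
    have hpos : ∀ t ∈ Ioo (1 : ℝ) 2, 0 < tangPressureDeriv (bdryData d a ψ φ) i x' t :=
      fun t ht => tangPressureDeriv_pos ha hψ hφ.continuousOn zero_le_one le_rfl hφ2 ht hx hi
        fun ρ hρ => pressureProfileDeriv_pos_of_one_lt hφ ht
          (lt_of_lt_of_le (pow_pos (by linarith) 2) hρ)
    refine ⟨hpos, pressureTime_le zero_le_one fun t ht1 ht2 => ?_⟩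
    -- Time 1 itself is not covered by the sign result; any s in (1, t) violates negativity.
    obtain ⟨s, hs1, hs2⟩ := exists_between ht1
    exact ⟨s, ⟨by linarith, hs2⟩, (hpos s ⟨hs1, hs2.trans ht2⟩).le⟩
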